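/- Let $\mathbb{C}(q)$ be the field of rational functions, $[n]=\frac{q^n-q^{-n}}{q-q^{-1}}$ for $n\in\mathbb{Z}$, and $[a,b]_p=ab-p\,ba$. Let $U_q'$ be the $\mathbb{C}(q)$-algebra (the quantum symmetric pair coideal subalgebra for $(\mathfrak{gl}_4,\mathfrak{gl}_2\times\mathfrak{gl}_2)$) generated by $B_0,B_1,B_{-1},\hat D_\diamondsuit^{\pm1},\hat D_1^{\pm1}$ subject to: $\hat D_j\hat D_j^{-1}=\hat D_j^{-1}\hat D_j=1$ for $j\in\{\diamondsuit,1\}$; $\hat D_\diamondsuit,\hat D_1$ commute with each other and with $B_0$; $$\hat D_\diamondsuit B_{\pm1}=q^{\pm1}B_{\pm1}\hat D_\diamondsuit,\qquad \hat D_1B_{\pm1}=q^{\mp1}B_{\pm1}\hat D_1,\qquad B_1B_{-1}-B_{-1}B_1=\frac{\hat D_\diamondsuit\hat D_1^{-1}-\hat D_1\hat D_\diamondsuit^{-1}}{q-q^{-1}},$$ $$B_0^2B_{\pm1}-[2]B_0B_{\pm1}B_0+B_{\pm1}B_0^2=B_{\pm1},\qquad B_{\pm1}^2B_0-[2]B_{\pm1}B_0B_{\pm1}+B_0B_{\pm1}^2=0.$$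 Put $X=[B_0,B_1]_{q^{-1}}$, $Y=[B_0,B_{-1}]_{q^{-1}}$, $Z=[B_1,Y]_{q^{-1}}$. A weight space of a $U_q'$-module is a simultaneous eigenspace of $\hat D_\diamondsuit,\hat D_1,B_0,Z$; a maximal vector is a nonzero vector in a weight space that is killed by $B_1$ and $X$. For $\kappa_\diamondsuit,\kappa_1\in\mathbb{Z}$ and $\beta,\zeta\in\mathbb{C}(q)$ the Verma module $\mathbb{M}(\kappa_\diamondsuit,\kappa_1,\beta,\zeta)$ is the $U_q'$-module generated by a universal vector killed by $B_1$ and $X$ on which $\hat D_\diamondsuit,\hat D_1,B_0,Z$ act by $q^{\kappa_\diamondsuit},q^{\kappa_1},\beta,\zeta$, and $\mathsf{L}(\kappa_\diamondsuit,\kappa_1,\beta,\zeta)$ is its unique irreducible quotient (the quotient by the sum of all proper submodules). Write $\kappa=\kappa_\diamondsuit-\kappa_1$. A $U_q'$-module is called rational if it is finite dimensional over $\mathbb{C}(q)$, $B_0$ acts diagonalizably with eigenvalues in $\{[n]\mid n\in\mathbb{Z}\}$, and $\hat D_\diamondsuit,\hat D_1$ act diagonalizably with eigenvalues in $q^{\mathbb{Z}}$.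 Theorem. (1) Every irreducible rational $U_q'$-module is isomorphic to $\mathsf{L}(\kappa_\diamondsuit,\kappa_1,[n],[n+\kappa-2i]-q^{-\kappa}[n])$ for some $\kappa_\diamondsuit,\kappa_1,n,i\in\mathbb{Z}$ with $0\le i\le\kappa$ (so $\kappa_\diamondsuit\ge\kappa_1$), and conversely each of these modules is irreducible and rational. (2) Let $\mathbf{P}_{1/2}=\{(\lambda_1,\lambda_2)\mid \lambda_1-\lambda_2\in\mathbb{Z}_{\ge0},\ 2\lambda_1,2\lambda_2\in\mathbb{Z}\}$. Taking the highest weight, that is, $$\mathsf{L}(\kappa_\diamondsuit,\kappa_1,[n],[n+\kappa-2i]-q^{-\kappa}[n])\longmapsto\Big(\big(\tfrac{\kappa_\diamondsuit+n}{2},\tfrac{\kappa_\diamondsuit+n}{2}-i\big),\big(\tfrac{\kappa_\diamondsuit-n}{2},\tfrac{\kappa_\diamondsuit-n}{2}-\kappa+i\big)\Big)\qquad(0\le i\le\kappa),$$ is a well-defined bijection from the set of isomorphism classes of irreducible rational $U_q'$-modules onto $$\{(\lambda,\mu)\in\mathbf{P}_{1/2}\times\mathbf{P}_{1/2}\mid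 \lambda_1-\mu_1\in\mathbb{Z}\}.$$ The value at the class of $V$ is given by the same formula whenever $V$ has a maximal vector of weight $(q^{\kappa_\diamondsuit},q^{\kappa_1},[n],[n+\kappa-2i]-q^{-\kappa}[n])$ with $0\le i\le\kappa$. (3) Every irreducible rational $U_q'$-module is, over $\mathbb{C}(q)$, the direct sum of its weight spaces, and each nonzero weight space is one-dimensional. -/

import Mathlib

namespace QSP

noncomputable section

/-- The ground field: rational functions in one variable over the complex numbers. -/
abbrev Cq : Type := RatFunc ℂ

/-- The variable of the ground field. -/
def q : Cq := RatFunc.X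

/-- The quantum integer `[n]`. -/
def qInt (n : ℤ) : Cq := (q ^ n - q ^ (-n)) / (q - q⁻¹)

/-- The generators; `Dd` is the generator indexed by the diamond, and `DdInv`, `D1Inv` are
the inverses of `Dd`, `D1`. -/
inductive Gen : Type
  | B0 | B1 | Bm1 | Dd | DdInv | D1 | D1Inv

/-- The free algebra on the generators. -/
abbrev Free : Type := FreeAlgebra Cq Gen

/-- A generator inside the free algebra. -/
def gen (g : Gen) : Free := FreeAlgebra.ι Cq g

/-- The defining relations of the coideal subalgebra. -/
inductive Rel : Free → Free → Prop
  | Dd_mul_inv : Rel (gen .Dd * gen .DdInv) 1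
  | Dd_inv_mul : Rel (gen .DdInv * gen .Dd) 1
  | D1_mul_inv : Rel (gen .D1 * gen .D1Inv) 1
  | D1_inv_mul : Rel (gen .D1Inv * gen .D1) 1
  | Dd_D1 : Rel (gen .Dd * gen .D1) (gen .D1 * gen .Dd)
  | Dd_B1 : Rel (gen .Dd * gen .B1) (q • (gen .B1 * gen .Dd))
  | Dd_Bm1 : Rel (gen .Dd * gen .Bm1) (q⁻¹ • (gen .Bm1 * gen .Dd))
  | D1_B1 : Rel (gen .D1 * gen .B1) (q⁻¹ • (gen .B1 * gen .D1))
  | D1_Bm1 : Rel (gen .D1 * gen .Bm1) (q • (gen .Bm1 * gen .D1))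
  | B0_Dd : Rel (gen .B0 * gen .Dd) (gen .Dd * gen .B0)
  | B0_D1 : Rel (gen .B0 * gen .D1) (gen .D1 * gen .B0)
  | B1_Bm1 : Rel (gen .B1 * gen .Bm1 - gen .Bm1 * gen .B1)
      ((q - q⁻¹)⁻¹ • (gen .Dd * gen .D1Inv - gen .D1 * gen .DdInv))
  | serre_B0_B1 : Rel
      (gen .B0 ^ 2 * gen .B1 - qInt 2 • (gen .B0 * gen .B1 * gen .B0) + gen .B1 * gen .B0 ^ 2)
      (gen .B1)
  | serre_B0_Bm1 : Rel
      (gen .B0 ^ 2 * gen .Bm1 - qInt 2 • (gen .B0 * gen .Bm1 * gen .B0) + gen .Bm1 * gen .B0 ^ 2)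
      (gen .Bm1)
  | serre_B1_B0 : Rel
      (gen .B1 ^ 2 * gen .B0 - qInt 2 • (gen .B1 * gen .B0 * gen .B1) + gen .B0 * gen .B1 ^ 2)
      0
  | serre_Bm1_B0 : Rel
      (gen .Bm1 ^ 2 * gen .B0 - qInt 2 • (gen .Bm1 * gen .B0 * gen .Bm1) + gen .B0 * gen .Bm1 ^ 2)
      0

/-- The quantum symmetric pair coideal subalgebra attached to `(gl₄, gl₂ × gl₂)`,
by generators and relations. -/
abbrev U : Type := RingQuot Rel

/-- The class of a generator in the algebra. -/
def cls (g : Gen) : U := RingQuot.mkAlgHom Cq Rel (gen g)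

def B0 : U := cls .B0
def B1 : U := cls .B1
def Bm1 : U := cls .Bm1
def Dd : U := cls .Dd
def D1 : U := cls .D1

/-- The twisted commutator `[a, b]_p = a b - p b a`. -/
def qComm (p : Cq) (a b : U) : U := a * b - p • (b * a)

def X : U := qComm q⁻¹ B0 B1
def Y : U := qComm q⁻¹ B0 Bm1
def Z : U := qComm q⁻¹ B1 Y

section Modules

variable (V : Type*) [AddCommGroup V] [Module Cq V] [Module U V] [IsScalarTower Cq U V]

/-- The operator on a module given by an element of the algebra. -/
def act (u : U) : Module.End Cq V := Algebra.lsmul Cq Cq V u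

/-- The action of `u` is diagonalizable with all its eigenvalues in `S`: the space is the sum
of the eigenspaces of `u` with eigenvalue in `S`. -/
def DiagonalizableIn (u : U) (S : Set Cq) : Prop :=
  ⨆ c ∈ S, (act V u).eigenspace c = ⊤

/-- Rational representations. -/
structure IsRational : Prop where
  finite : Module.Finite Cq V
  diag_B0 : DiagonalizableIn V B0 (Set.range qInt)
  diag_Dd : DiagonalizableIn V Dd (Set.range fun n : ℤ => q ^ n)
  diag_D1 : DiagonalizableIn V D1 (Set.range fun n : ℤ => q ^ n)

/-- The weight space: the simultaneous eigenspace of `Dd`, `D1`, `B0`, `Z` with the eigenvalues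
`w.1`, `w.2.1`, `w.2.2.1`, `w.2.2.2`. -/
def weightSpace (w : Cq × Cq × Cq × Cq) : Submodule Cq V :=
  (act V Dd).eigenspace w.1 ⊓ (act V D1).eigenspace w.2.1 ⊓
    (act V B0).eigenspace w.2.2.1 ⊓ (act V Z).eigenspace w.2.2.2

/-- The module is the direct sum of its weight spaces, and each nonzero weight space is
one-dimensional. -/
structure IsSumOfWeightLines : Prop where
  independent : iSupIndep (weightSpace V)
  iSup_eq_top : ⨆ w, weightSpace V w = ⊤
  finrank_eq_one : ∀ w, weightSpace V w ≠ ⊥ → Module.finrank Cq (weightSpace V w) = 1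

/-- A (nonzero) maximal vector of weight `(q ^ κd, q ^ κ1, β, ζ)`. -/
structure IsMaximalVector (κd κ1 : ℤ) (β ζ : Cq) (v : V) : Prop where
  ne_zero : v ≠ 0
  mem_weightSpace : v ∈ weightSpace V (q ^ κd, q ^ κ1, β, ζ)
  B1_smul : B1 • v = 0
  X_smul : X • v = 0

end Modules

/-- The left ideal annihilating the highest weight vector of the Verma module: it is generated by
the elements by which the positive and the Cartan part differ from their action on the
one-dimensional module of highest weight `(κd, κ1, β, ζ)`. -/
def vermaIdeal (κd κ1 : ℤ) (β ζ : Cq) : Submodule U U :=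
  Submodule.span U
    {B1, X, Dd - algebraMap Cq U (q ^ κd), D1 - algebraMap Cq U (q ^ κ1),
      B0 - algebraMap Cq U β, Z - algebraMap Cq U ζ}

/-- The Verma module of highest weight `(κd, κ1, β, ζ)`. -/
abbrev Verma (κd κ1 : ℤ) (β ζ : Cq) : Type := U ⧸ vermaIdeal κd κ1 β ζ

/-- The sum of all proper submodules of the Verma module. -/
def vermaRadical (κd κ1 : ℤ) (β ζ : Cq) : Submodule U (Verma κd κ1 β ζ) :=
  sSup {N | N ≠ ⊤}

/-- The irreducible quotient of the Verma module. -/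
abbrev L (κd κ1 : ℤ) (β ζ : Cq) : Type := Verma κd κ1 β ζ ⧸ vermaRadical κd κ1 β ζ

/-- The dominant value `[n + κ - 2 i] - q ^ (-κ) [n]` with `κ = κd - κ1`. -/
def domZeta (κd κ1 n i : ℤ) : Cq :=
  qInt (n + (κd - κ1) - 2 * i) - q ^ (-(κd - κ1)) * qInt n

/-- An irreducible rational representation. -/
structure RatIrrep where
  carrier : Type
  [addCommGroup : AddCommGroup carrier]
  [moduleCq : Module Cq carrier]
  [moduleU : Module U carrier]
  [isScalarTower : IsScalarTower Cq U carrier]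
  rational : IsRational carrier
  irreducible : IsSimpleModule U carrier

attribute [instance] RatIrrep.addCommGroup RatIrrep.moduleCq RatIrrep.moduleU
  RatIrrep.isScalarTower

/-- Isomorphism of irreducible rational representations. -/
instance RatIrrep.isoSetoid : Setoid RatIrrep where
  r V W := Nonempty (V.carrier ≃ₗ[U] W.carrier)
  iseqv :=
    { refl := fun _ => ⟨LinearEquiv.refl _ _⟩
      symm := fun ⟨e⟩ => ⟨e.symm⟩
      trans := fun ⟨e⟩ ⟨f⟩ => ⟨e.trans f⟩ }

/-- Isomorphism classes of irreducible rational representations. -/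
abbrev RatIrrepClass : Type 1 := Quotient RatIrrep.isoSetoid

/-- Pairs of half-integers with difference a nonnegative integer. -/
def PHalf : Set (ℚ × ℚ) :=
  {l | (∃ k : ℕ, l.1 - l.2 = k) ∧ (∃ a : ℤ, 2 * l.1 = a) ∧ ∃ b : ℤ, 2 * l.2 = b}

/-- Pairs of elements of `PHalf` whose entries are congruent modulo the integers. -/
def PHalfPairs : Set ((ℚ × ℚ) × (ℚ × ℚ)) :=
  {p | p.1 ∈ PHalf ∧ p.2 ∈ PHalf ∧ ∃ m : ℤ, p.1.1 - p.2.1 = m}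

/-- The pair attached to the highest weight `(κd, κ1, [n], [n + κ - 2 i] - q ^ (-κ) [n])`. -/
def label (κd κ1 n i : ℤ) : (ℚ × ℚ) × (ℚ × ℚ) :=
  ((((κd : ℚ) + n) / 2, ((κd : ℚ) + n) / 2 - i),
    (((κd : ℚ) - n) / 2, ((κd : ℚ) - n) / 2 - ((κd : ℚ) - κ1) + i))

end

end QSP

/-
The idea is highest weight theory for a rank one algebra. If `w` has `B0`-eigenvalue `[k]`, the
second-order Serre relation splits `span {Bm1 • w, Y • w}` into `B0`-eigenvectors of eigenvalues
`[k + 1]` and `[k - 1]`, so `Bm1` is replaced by two lowering operators. Up to the shifts of `k`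
these commute, and `Z`, which commutes with `B0`, `Dd` and `D1`, acts on their products by scalars.
Hence a maximal vector `v` generates the span of the vectors obtained by lowering `v` `a` times in
one direction and `b` times in the other; these lie in distinct weight spaces, which gives the
decomposition into weight lines and the unique maximal submodule.

In a finite-dimensional module, lowering in either direction ends at zero, and applying `B1` at the
first zero determines `ζ`, once in terms of the number of steps in each direction; comparing the two
values gives `ζ = [n + κ - 2 i] - q ^ (-κ) [n]` with `0 ≤ i ≤ κ`. Conversely, for each such `i`
there is an explicit module with a basis indexed by `ℤ × ℤ`, whose rectangle `[0, κ - i] × [0, i]`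
spans a finite-dimensional submodule with the required maximal vector at its corner `(0, 0)`.
-/

namespace QSP

noncomputable section

/-! ### Quantum integers -/

-- Instance search otherwise finds the algebra structures that `RatFunc` inherits from polynomials,
-- which `module` and `match_scalars` do not recognize as the canonical ones.
instance : Algebra ℕ Cq := Semiring.toNatAlgebra

instance : Algebra ℤ Cq := Ring.toIntAlgebra Cq

theorem q_ne_zero : q ≠ 0 := RatFunc.X_ne_zero

theorem intDegree_q_zpow (n : ℤ) : RatFunc.intDegree (q ^ n) = n := by
  have h (m : ℕ) : RatFunc.intDegree (q ^ m) = m := by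
    induction m with
    | zero => simp
    | succ m ih =>
      rw [pow_succ, RatFunc.intDegree_mul (pow_ne_zero m q_ne_zero) q_ne_zero, ih, q,
        RatFunc.intDegree_X, Nat.cast_succ]
  obtain ⟨m, rfl | rfl⟩ := n.eq_nat_or_neg
  · rw [zpow_natCast, h]
  · rw [zpow_neg, zpow_natCast, RatFunc.intDegree_inv, h]

theorem q_zpow_injective : Function.Injective fun n : ℤ => q ^ n :=
  Function.LeftInverse.injective intDegree_q_zpow

theorem q_zpow_ne_neg_one (n : ℤ) : q ^ n ≠ -1 := by
  intro h
  obtain rfl : n = 0 := by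
    rw [← intDegree_q_zpow n, h, RatFunc.intDegree_neg, RatFunc.intDegree_one]
  exact absurd h (by norm_num)

theorem q_sq_sub_one_ne_zero : q ^ 2 - 1 ≠ 0 := by
  have h : q ^ (2 : ℤ) ≠ q ^ (0 : ℤ) := q_zpow_injective.ne two_ne_zero
  rw [zpow_zero] at h
  exact_mod_cast sub_ne_zero.mpr h

theorem q_sub_inv_ne_zero : q - q⁻¹ ≠ 0 := by
  have h0 := q_ne_zero
  intro h
  apply q_sq_sub_one_ne_zero
  linear_combination q * h + mul_inv_cancel₀ h0

/-- The sum `q ^ n + q ^ (-n)`; these are the denominators in the action of the algebra on its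
finite-dimensional modules. -/
def qCosh (n : ℤ) : Cq := q ^ n + q ^ (-n)

theorem qCosh_ne_zero (n : ℤ) : qCosh n ≠ 0 := by
  intro h
  apply q_zpow_ne_neg_one (n + n)
  have hn : q ^ n * q ^ (-n) = 1 := by rw [← zpow_add₀ q_ne_zero, add_neg_cancel, zpow_zero]
  rw [zpow_add₀ q_ne_zero]
  unfold qCosh at h
  linear_combination q ^ n * h - hn

theorem qInt_zero : qInt 0 = 0 := by
  simp [qInt]

theorem qInt_one : qInt 1 = 1 := by
  rw [qInt, zpow_one, zpow_neg_one, div_self q_sub_inv_ne_zero]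

theorem qInt_neg (n : ℤ) : qInt (-n) = -qInt n := by
  simp only [qInt, neg_neg]
  ring

theorem qInt_sub_qInt (m n : ℤ) :
    qInt m - qInt n = q ^ (-m) * (q ^ (m - n) - 1) * (q ^ (m + n) + 1) / (q - q⁻¹) := by
  have h0 := q_ne_zero
  simp only [qInt, ← sub_div, zpow_neg, zpow_add₀ h0, zpow_sub₀ h0]
  field_simp
  ring

theorem qInt_injective : Function.Injective qInt := by
  intro m n h
  have h0 : q ^ (-m) * (q ^ (m - n) - 1) * (q ^ (m + n) + 1) / (q - q⁻¹) = 0 := by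
    rw [← qInt_sub_qInt, h, sub_self]
  rw [div_eq_zero_iff, or_iff_left q_sub_inv_ne_zero, mul_eq_zero,
    or_iff_left fun h => q_zpow_ne_neg_one _ (eq_neg_of_add_eq_zero_left h), mul_eq_zero,
    or_iff_right (zpow_ne_zero _ q_ne_zero), sub_eq_zero, ← zpow_zero q] at h0
  exact sub_eq_zero.mp (q_zpow_injective h0)

theorem qInt_ne_zero {n : ℤ} (hn : n ≠ 0) : qInt n ≠ 0 :=
  fun h => hn (qInt_injective (h.trans qInt_zero.symm))

theorem qInt_two : qInt 2 = q + q⁻¹ := by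
  rw [qInt, div_eq_iff q_sub_inv_ne_zero, zpow_neg, zpow_two]
  ring

theorem qInt_succ (n : ℤ) : qInt (n + 1) = q⁻¹ * qInt n + q ^ n := by
  have h0 := q_ne_zero
  have h1 := q_sq_sub_one_ne_zero
  simp only [qInt, neg_add, zpow_neg, zpow_add₀ h0, zpow_one]
  field_simp
  ring

/-! ### Relations in the algebra -/

theorem mk_rel {a b : Free} (h : Rel a b) :
    RingQuot.mkAlgHom Cq Rel a = RingQuot.mkAlgHom Cq Rel b :=
  RingQuot.mkAlgHom_rel Cq h

/-- `Dd` as a unit of the algebra. -/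
def DdUnit : Uˣ where
  val := Dd
  inv := cls .DdInv
  val_inv := by simpa [Dd, cls] using mk_rel .Dd_mul_inv
  inv_val := by simpa [Dd, cls] using mk_rel .Dd_inv_mul

/-- `D1` as a unit of the algebra. -/
def D1Unit : Uˣ where
  val := D1
  inv := cls .D1Inv
  val_inv := by simpa [D1, cls] using mk_rel .D1_mul_inv
  inv_val := by simpa [D1, cls] using mk_rel .D1_inv_mul

/-- The commutator of `B1` and `Bm1`, the Cartan element of the subalgebra they generate. -/
def H : U := (q - q⁻¹)⁻¹ • (Dd * ↑D1Unit⁻¹ - D1 * ↑DdUnit⁻¹)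

theorem commute_Dd_D1 : Commute Dd D1 := by
  simpa [commute_iff_eq, D1, Dd, cls] using mk_rel .Dd_D1

theorem commute_B0_Dd : Commute B0 Dd := by
  simpa [commute_iff_eq, B0, Dd, cls] using mk_rel .B0_Dd

theorem commute_B0_D1 : Commute B0 D1 := by
  simpa [commute_iff_eq, B0, D1, cls] using mk_rel .B0_D1

theorem semiconjBy_Dd_B1 : SemiconjBy Dd B1 (q • B1) := by
  simpa [SemiconjBy, B1, Dd, cls] using mk_rel .Dd_B1

theorem semiconjBy_Dd_Bm1 : SemiconjBy Dd Bm1 (q⁻¹ • Bm1) := by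
  simpa [SemiconjBy, Bm1, Dd, cls] using mk_rel .Dd_Bm1

theorem semiconjBy_D1_B1 : SemiconjBy D1 B1 (q⁻¹ • B1) := by
  simpa [SemiconjBy, B1, D1, cls] using mk_rel .D1_B1

theorem semiconjBy_D1_Bm1 : SemiconjBy D1 Bm1 (q • Bm1) := by
  simpa [SemiconjBy, Bm1, D1, cls] using mk_rel .D1_Bm1

theorem B1_mul_Bm1 : B1 * Bm1 = Bm1 * B1 + H := by
  have h := mk_rel .B1_Bm1
  simp only [map_mul, map_sub, map_smul] at h
  exact sub_eq_iff_eq_add'.mp h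

theorem serre_B0_B1 : B0 ^ 2 * B1 - qInt 2 • (B0 * B1 * B0) + B1 * B0 ^ 2 = B1 := by
  simpa only [B0, B1, cls, map_mul, map_sub, map_add, map_smul, map_pow] using
    mk_rel .serre_B0_B1

theorem serre_B0_Bm1 : B0 ^ 2 * Bm1 - qInt 2 • (B0 * Bm1 * B0) + Bm1 * B0 ^ 2 = Bm1 := by
  simpa only [B0, Bm1, cls, map_mul, map_sub, map_add, map_smul, map_pow] using
    mk_rel .serre_B0_Bm1

theorem serre_Bm1_B0 : Bm1 ^ 2 * B0 - qInt 2 • (Bm1 * B0 * Bm1) + B0 * Bm1 ^ 2 = 0 := by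
  simpa only [Bm1, B0, cls, map_mul, map_sub, map_add, map_smul, map_pow, map_zero] using
    mk_rel .serre_Bm1_B0

theorem semiconjBy_qComm {a b c : U} {x y : Cq} (hb : SemiconjBy a b (x • b))
    (hc : SemiconjBy a c (y • c)) (p : Cq) :
    SemiconjBy a (qComm p b c) ((x * y) • qComm p b c) := by
  have hbc := (hb.mul_right hc).eq
  have hcb := (hc.mul_right hb).eq
  simp only [smul_mul_smul_comm] at hbc hcb
  rw [SemiconjBy, qComm, mul_sub, mul_smul_comm, hbc, hcb, mul_comm y x]
  simp only [smul_sub, sub_mul, smul_mul_assoc, smul_comm p]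

theorem semiconjBy_Dd_Y : SemiconjBy Dd Y (q⁻¹ • Y) := by
  have h : SemiconjBy Dd B0 ((1 : Cq) • B0) := (one_smul Cq B0).symm ▸ commute_B0_Dd.symm
  simpa [Y] using semiconjBy_qComm h semiconjBy_Dd_Bm1 q⁻¹

theorem semiconjBy_D1_Y : SemiconjBy D1 Y (q • Y) := by
  have h : SemiconjBy D1 B0 ((1 : Cq) • B0) := (one_smul Cq B0).symm ▸ commute_B0_D1.symm
  simpa [Y] using semiconjBy_qComm h semiconjBy_D1_Bm1 q⁻¹

theorem commute_Dd_Z : Commute Dd Z := by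
  simpa [q_ne_zero, Z, Commute] using semiconjBy_qComm semiconjBy_Dd_B1 semiconjBy_Dd_Y q⁻¹

theorem commute_D1_Z : Commute D1 Z := by
  simpa [q_ne_zero, Z, Commute] using semiconjBy_qComm semiconjBy_D1_B1 semiconjBy_D1_Y q⁻¹

theorem commute_B0_H : Commute B0 H :=
  have hd : Commute B0 ↑DdUnit⁻¹ := commute_B0_Dd.units_inv_right (u := DdUnit)
  have h1 : Commute B0 ↑D1Unit⁻¹ := commute_B0_D1.units_inv_right (u := D1Unit)
  ((commute_B0_Dd.mul_right h1).sub_right (commute_B0_D1.mul_right hd)).smul_right _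

theorem B0_mul_X : B0 * X = q • (X * B0) + B1 := by
  have h0 := q_ne_zero
  linear_combination (norm := skip) serre_B0_B1
  simp only [X, qComm, qInt_two, mul_sub, sub_mul, smul_mul_assoc, mul_smul_comm, mul_assoc,
    pow_two]
  match_scalars <;> field_simp <;> ring

theorem B0_mul_Y : B0 * Y = q • (Y * B0) + Bm1 := by
  have h0 := q_ne_zero
  linear_combination (norm := skip) serre_B0_Bm1
  simp only [Y, qComm, qInt_two, mul_sub, sub_mul, smul_mul_assoc, mul_smul_comm, mul_assoc,
    pow_two]
  match_scalars <;> field_simp <;> ring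

theorem Y_mul_Bm1 : Y * Bm1 = q • (Bm1 * Y) := by
  have h0 := q_ne_zero
  linear_combination (norm := skip) serre_Bm1_B0
  simp only [Y, qComm, qInt_two, mul_sub, sub_mul, smul_mul_assoc, mul_smul_comm, mul_assoc,
    pow_two]
  match_scalars <;> field_simp <;> ring

theorem B0_mul_Bm1 : B0 * Bm1 = Y + q⁻¹ • (Bm1 * B0) := by
  rw [Y, qComm, sub_add_cancel]

theorem B1_mul_Y : B1 * Y = q⁻¹ • (Y * B1) + Z := by
  rw [Z, qComm, add_sub_cancel]

theorem X_mul_Bm1 :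
    X * Bm1 = q⁻¹ • (Bm1 * X) + (1 - q⁻¹ ^ 2) • (Y * B1 + H * B0) - q⁻¹ • Z := by
  linear_combination (norm := skip)
    B0 * B1_mul_Bm1 - q⁻¹ ^ 2 • (B1_mul_Bm1 * B0) + commute_B0_H.eq
  simp only [X, Y, Z, qComm, mul_sub, sub_mul, mul_add, add_mul, smul_mul_assoc, mul_smul_comm,
    mul_assoc]
  module

theorem Z_mul_Bm1 : Z * Bm1 = q • (Bm1 * Z) + q • (H * Y) - q⁻¹ • (Y * H) := by
  linear_combination (norm := skip) B1 * Y_mul_Bm1 + q • (B1_mul_Bm1 * Y) -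
    q⁻¹ • (Y * B1_mul_Bm1) - q⁻¹ • (Y_mul_Bm1 * B1)
  simp only [Z, qComm, mul_sub, sub_mul, mul_add, add_mul, smul_mul_assoc, mul_smul_comm,
    mul_assoc]
  module

theorem lie_B0_Z : ⁅B0, Z⁆ = ⁅X, Y⁆ + q⁻¹ • H := by
  have h0 := q_ne_zero
  linear_combination (norm := skip)
    q⁻¹ • (B1 * B0_mul_Y) - q⁻¹ • (B0_mul_Y * B1) + q⁻¹ • B1_mul_Bm1
  simp only [Ring.lie_def, X, Z, qComm, mul_sub, sub_mul, mul_add, add_mul, smul_mul_assoc,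
    mul_smul_comm, mul_assoc]
  match_scalars <;> field_simp <;> ring

theorem lie_B0_X_mul_Bm1 : ⁅B0, X * Bm1⁆ = q • (X * Y) + B1 * Bm1 := by
  have h0 := q_ne_zero
  linear_combination (norm := skip) B0_mul_X * Bm1
  simp only [Ring.lie_def, Y, qComm, mul_sub, add_mul, smul_mul_assoc, mul_smul_comm, mul_assoc]
  match_scalars <;> field_simp <;> ring

theorem lie_B0_X_mul_Bm1' : ⁅B0, X * Bm1⁆ = q • (Y * X) + Bm1 * B1 - q⁻¹ • ⁅B0, Z⁆ := by
  have h0 := q_ne_zero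
  have hX : ⁅B0, Bm1 * X⁆ = Y * X + q⁻¹ • (Bm1 * B1) := by
    linear_combination (norm := skip) q⁻¹ • (Bm1 * B0_mul_X)
    simp only [Ring.lie_def, Y, qComm, sub_mul, mul_add, smul_mul_assoc, mul_smul_comm, mul_assoc]
    match_scalars <;> field_simp <;> ring
  have hY : ⁅B0, Y * B1⁆ = q • (Y * X) + Bm1 * B1 := by
    linear_combination (norm := skip) B0_mul_Y * B1
    simp only [Ring.lie_def, X, qComm, mul_sub, add_mul, smul_mul_assoc, mul_smul_comm, mul_assoc]
    match_scalars <;> field_simp <;> ring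
  have hH : ⁅B0, H * B0⁆ = 0 :=
    commute_iff_lie_eq.mp (commute_B0_H.mul_right (Commute.refl B0))
  linear_combination (norm := skip) B0 * X_mul_Bm1 - X_mul_Bm1 * B0 + q⁻¹ • hX +
    (1 - q⁻¹ ^ 2) • (hY + hH)
  simp only [Ring.lie_def, mul_add, add_mul, mul_sub, sub_mul, mul_smul_comm, smul_mul_assoc]
  match_scalars <;> field_simp <;> ring

theorem commute_B0_Z : Commute B0 Z := by
  have h0 := q_ne_zero
  have h : (q + q⁻¹) • ⁅B0, Z⁆ = 0 := by
    linear_combination (norm := skip)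
      q • lie_B0_Z + lie_B0_X_mul_Bm1' - lie_B0_X_mul_Bm1 - B1_mul_Bm1
    simp only [Ring.lie_def]
    match_scalars <;> field_simp <;> ring
  have h2 : q + q⁻¹ ≠ 0 := qInt_two ▸ qInt_ne_zero two_ne_zero
  exact commute_iff_lie_eq.mpr ((smul_eq_zero.mp h).resolve_left h2)

/-! ### Lowering operators -/

/-- The combination of `Y` and `Bm1` that sends the `[k]`-eigenspace of `B0` to the
`[k + ε]`-eigenspace. -/
def lowering (ε : ℤˣ) (k : ℤ) : U := Y + ((ε : ℤ) * q ^ (-(ε * k)) : Cq) • Bm1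

/-- The product of `m` lowering operators that sends the `[k]`-eigenspace of `B0` to the
`[k + ε * m]`-eigenspace. -/
def loweringPow (ε : ℤˣ) (k : ℤ) : ℕ → U
  | 0 => 1
  | m + 1 => lowering ε (k + ε * m) * loweringPow ε k m

theorem lowering_neg_one_mul_lowering_one (k : ℤ) :
    lowering (-1) (k + 1) * lowering 1 k = lowering 1 (k - 1) * lowering (-1) k := by
  have h0 := q_ne_zero
  simp only [lowering, mul_add, add_mul, smul_mul_assoc, mul_smul_comm, Y_mul_Bm1,
    Units.val_neg, Units.val_one, Int.cast_neg, Int.cast_one, neg_mul, one_mul, neg_neg]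
  match_scalars <;> simp only [neg_sub, neg_add, zpow_neg, zpow_add₀ h0, zpow_sub₀ h0, zpow_one]
  all_goals field_simp
  all_goals ring

theorem semiconjBy_Dd_lowering (ε : ℤˣ) (k : ℤ) :
    SemiconjBy Dd (lowering ε k) (q⁻¹ • lowering ε k) := by
  simp only [SemiconjBy, lowering, mul_add, add_mul, smul_add, mul_smul_comm, smul_mul_assoc,
    semiconjBy_Dd_Y.eq, semiconjBy_Dd_Bm1.eq, smul_comm q⁻¹]

theorem semiconjBy_D1_lowering (ε : ℤˣ) (k : ℤ) :
    SemiconjBy D1 (lowering ε k) (q • lowering ε k) := by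
  simp only [SemiconjBy, lowering, mul_add, add_mul, smul_add, mul_smul_comm, smul_mul_assoc,
    semiconjBy_D1_Y.eq, semiconjBy_D1_Bm1.eq, smul_comm q]

theorem B1_mul_lowering (ε : ℤˣ) (k : ℤ) :
    B1 * lowering ε (k + ε) =
      q⁻¹ • (lowering ε k * B1) + Z + ((ε : ℤ) * q ^ (-(ε * k + 1)) : Cq) • H := by
  have h0 := q_ne_zero
  rw [lowering, lowering, mul_add (ε : ℤ), ← Units.val_mul, Int.units_mul_self, Units.val_one,
    mul_add, mul_smul_comm, B1_mul_Y, B1_mul_Bm1, add_mul, smul_mul_assoc]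
  match_scalars <;> simp only [neg_add, zpow_add₀ h0, zpow_neg_one, mul_one]
  all_goals ring

section WeightVectors

variable {V : Type*} [AddCommGroup V] [Module Cq V] [Module U V] [IsScalarTower Cq U V]

theorem smul_scalar_smul (u : U) (c : Cq) (w : V) : u • c • w = c • u • w :=
  smul_comm u c w

theorem smul_smul_of_semiconjBy {a u : U} {x c : Cq} {w : V} (h : SemiconjBy a u (x • u))
    (hw : a • w = c • w) : a • u • w = (x * c) • u • w := by
  rw [← mul_smul, h.eq, mul_smul, hw, smul_assoc, smul_comm u c w, smul_smul]

theorem smul_smul_of_commute {a u : U} {c : Cq} {w : V} (h : Commute a u)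
    (hw : a • w = c • w) : a • u • w = c • u • w := by
  rw [← mul_smul, h.eq, mul_smul, hw, smul_comm]

theorem units_inv_smul {a : Uˣ} {c : Cq} {w : V} (hc : c ≠ 0) (hw : (a : U) • w = c • w) :
    (↑a⁻¹ : U) • w = c⁻¹ • w := by
  rw [eq_inv_smul_iff₀ hc, smul_comm, ← hw, ← mul_smul, a.inv_mul, one_smul]

theorem H_smul {d e : ℤ} {w : V} (hd : Dd • w = q ^ d • w) (he : D1 • w = q ^ e • w) :
    H • w = qInt (d - e) • w := by
  have h0 := q_ne_zero
  have hd' : (↑DdUnit⁻¹ : U) • w = q ^ (-d) • w := by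
    rw [zpow_neg, units_inv_smul (zpow_ne_zero d h0) hd]
  have he' : (↑D1Unit⁻¹ : U) • w = q ^ (-e) • w := by
    rw [zpow_neg, units_inv_smul (zpow_ne_zero e h0) he]
  rw [H, smul_assoc, sub_smul, mul_smul, mul_smul, hd', he', smul_comm Dd, smul_comm D1, hd, he]
  match_scalars
  simp only [qInt, zpow_neg, zpow_sub₀ h0]
  field_simp

theorem B1_smul_lowering_smul (ε : ℤˣ) (k : ℤ) (x : V) :
    B1 • lowering ε k • x =
      q⁻¹ • lowering ε (k - ε) • B1 • x + Z • x + ((ε : ℤ) * q ^ (-(ε * k)) : Cq) • H • x := by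
  have hε : (ε : ℤ) * ε = 1 := by rw [← Units.val_mul, Int.units_mul_self, Units.val_one]
  have h := B1_mul_lowering ε (k - ε)
  rw [sub_add_cancel, mul_sub, hε, sub_add_cancel] at h
  rw [← mul_smul, h, add_smul, add_smul, smul_assoc, smul_assoc, mul_smul]

/-- The vector `w` lies in the simultaneous eigenspace of `Dd`, `D1`, `B0` with eigenvalues
`q ^ d`, `q ^ e`, `[k]`; unlike for `weightSpace`, nothing is required of `Z`. -/
structure IsWeightVector (d e k : ℤ) (w : V) : Prop where
  Dd_smul : Dd • w = q ^ d • w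
  D1_smul : D1 • w = q ^ e • w
  B0_smul : B0 • w = qInt k • w

namespace IsWeightVector

variable {d e k : ℤ} {w : V}

theorem B0_smul_Y (hw : IsWeightVector d e k w) :
    B0 • Y • w = (q * qInt k) • Y • w + Bm1 • w := by
  rw [← mul_smul, B0_mul_Y, add_smul, smul_assoc, mul_smul, hw.B0_smul, smul_comm Y, smul_smul]

theorem B0_smul_Bm1 (hw : IsWeightVector d e k w) :
    B0 • Bm1 • w = Y • w + (q⁻¹ * qInt k) • Bm1 • w := by
  rw [← mul_smul, B0_mul_Bm1, add_smul, smul_assoc, mul_smul, hw.B0_smul, smul_comm Bm1,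
    smul_smul]

theorem Z_smul (hw : IsWeightVector d e k w) : IsWeightVector d e k (Z • w) where
  Dd_smul := smul_smul_of_commute commute_Dd_Z hw.Dd_smul
  D1_smul := smul_smul_of_commute commute_D1_Z hw.D1_smul
  B0_smul := smul_smul_of_commute commute_B0_Z hw.B0_smul

theorem lowering_smul (hw : IsWeightVector d e k w) (ε : ℤˣ) :
    IsWeightVector (d - 1) (e + 1) (k + ε) (lowering ε k • w) where
  Dd_smul := by
    rw [smul_smul_of_semiconjBy (semiconjBy_Dd_lowering ε k) hw.Dd_smul, zpow_sub_one₀ q_ne_zero,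
      mul_comm]
  D1_smul := by
    rw [smul_smul_of_semiconjBy (semiconjBy_D1_lowering ε k) hw.D1_smul, zpow_add_one₀ q_ne_zero,
      mul_comm]
  B0_smul := by
    have h0 := q_ne_zero
    have h1 := q_sq_sub_one_ne_zero
    rw [lowering, add_smul, smul_assoc, smul_add, smul_scalar_smul, hw.B0_smul_Y,
      hw.B0_smul_Bm1]
    generalize Y • w = y
    generalize Bm1 • w = f
    rcases Int.units_eq_one_or ε with rfl | rfl <;> match_scalars <;>
      simp [qInt, zpow_add₀ h0] <;> field_simp <;> ring

theorem loweringPow_smul (hw : IsWeightVector d e k w) (ε : ℤˣ) (m : ℕ) :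
    IsWeightVector (d - m) (e + m) (k + ε * m) (loweringPow ε k m • w) := by
  induction m with
  | zero => simpa [loweringPow] using hw
  | succ m ih =>
    rw [loweringPow, mul_smul]
    convert ih.lowering_smul ε using 1 <;> push_cast <;> ring

theorem Z_smul_Bm1 (hw : IsWeightVector d e k w) :
    Z • Bm1 • w = q • Bm1 • Z • w - (qInt 2 * q ^ (1 - (d - e))) • Y • w := by
  have h0 := q_ne_zero
  have h1 := q_sq_sub_one_ne_zero
  have hY : H • Y • w = qInt (d - 1 - (e + 1)) • Y • w := by
    apply H_smul
    · rw [smul_smul_of_semiconjBy semiconjBy_Dd_Y hw.Dd_smul, zpow_sub_one₀ h0, mul_comm]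
    · rw [smul_smul_of_semiconjBy semiconjBy_D1_Y hw.D1_smul, zpow_add_one₀ h0, mul_comm]
  rw [← mul_smul, Z_mul_Bm1, sub_smul, add_smul, smul_assoc, smul_assoc, smul_assoc, mul_smul,
    mul_smul, mul_smul, hY, H_smul hw.Dd_smul hw.D1_smul, smul_comm Y]
  generalize Y • w = y
  generalize Bm1 • Z • w = f
  match_scalars
  · ring
  · simp only [qInt_two]
    simp only [qInt, neg_sub, zpow_sub₀ h0, zpow_add₀ h0, zpow_one]
    field_simp
    ring

theorem Z_smul_Y (hw : IsWeightVector d e k w) :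
    Z • Y • w = q • Y • Z • w -
      (qInt 2 * q ^ (1 - (d - e))) • (Bm1 • w + ((q - q⁻¹) * qInt k) • Y • w) := by
  have h0 := q_ne_zero
  have hY : Y • w = B0 • Bm1 • w - (q⁻¹ * qInt k) • Bm1 • w := by
    rw [hw.B0_smul_Bm1, add_sub_cancel_right]
  have hZ : Z • B0 • Bm1 • w = B0 • Z • Bm1 • w := by
    rw [← mul_smul, ← commute_B0_Z.eq, mul_smul]
  nth_rewrite 1 [hY]
  rw [smul_sub, hZ, smul_scalar_smul, hw.Z_smul_Bm1, smul_sub, smul_scalar_smul, smul_scalar_smul,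
    hw.Z_smul.B0_smul_Bm1, hw.B0_smul_Y]
  generalize Y • w = y
  generalize Bm1 • w = f
  generalize Y • Z • w = y'
  generalize Bm1 • Z • w = f'
  match_scalars <;> field_simp <;> ring

theorem Z_smul_lowering (hw : IsWeightVector d e k w) (ε : ℤˣ) :
    Z • lowering ε k • w =
      lowering ε k • (q • Z • w - (ε * qInt 2 * q ^ (ε * k + 1 - (d - e))) • w) := by
  have h0 := q_ne_zero
  have h1 := q_sq_sub_one_ne_zero
  simp only [lowering, add_smul, smul_assoc, smul_add, smul_sub, smul_scalar_smul,
    hw.Z_smul_Y, hw.Z_smul_Bm1, qInt_two]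
  generalize Y • w = y
  generalize Bm1 • w = f
  generalize Y • Z • w = y'
  generalize Bm1 • Z • w = f'
  generalize d - e = c
  rcases Int.units_eq_one_or ε with rfl | rfl <;> match_scalars <;>
    simp [qInt, zpow_add₀ h0, zpow_sub₀ h0] <;> field_simp <;> ring

theorem Z_smul_loweringPow (hw : IsWeightVector d e k w) (ε : ℤˣ) (m : ℕ) :
    Z • loweringPow ε k m • w = loweringPow ε k m • (q ^ (m : ℤ) • Z • w -
      (ε * qInt 2 * q ^ (ε * k - (d - e) + 2 * m - 1) * qInt m) • w) := by
  have h0 := q_ne_zero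
  have h1 := q_sq_sub_one_ne_zero
  induction m with
  | zero => simp [loweringPow, qInt_zero]
  | succ m ih =>
    have hε : (ε : ℤ) * ε = 1 := by
      rw [← Units.val_mul, Int.units_mul_self, Units.val_one]
    rw [loweringPow, mul_smul, mul_smul, (hw.loweringPow_smul ε m).Z_smul_lowering, ih,
      ← smul_scalar_smul, ← smul_scalar_smul (loweringPow ε k m), ← smul_sub]
    congr 2
    generalize Z • w = z
    rw [show (ε : ℤ) * (k + ε * m) + 1 - (d - m - (e + m)) =
      ε * k - (d - e) + m + m + m + 1 by linear_combination (m : ℤ) * hε]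
    generalize (ε : ℤ) * k - (d - e) = c
    push_cast
    match_scalars
    · rw [zpow_add_one₀ h0]
      ring
    · simp only [qInt_two, two_mul, mul_one]
      simp only [qInt, zpow_neg, zpow_sub₀ h0, zpow_add₀ h0, zpow_one]
      field_simp
      ring

theorem B1_smul_loweringPow_coeff (ε : ℤˣ) (c k m : ℤ) :
    q⁻¹ * qInt m * (q ^ (-c) * qInt k - qInt (k - ε * (c - 2 * m + 2))) -
        ε * qInt 2 * q ^ (ε * k - c + 2 * m - 1) * qInt m +
        ε * q ^ (-(ε * k + m)) * qInt (c - 2 * m) =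
      qInt (m + 1) * (q ^ (-c) * qInt k - qInt (k - ε * (c - 2 * m))) := by
  have h0 := q_ne_zero
  have h1 := q_sq_sub_one_ne_zero
  have h2 (x : ℤ) : q ^ (2 * x) = q ^ x * q ^ x := by rw [two_mul, zpow_add₀ h0]
  simp only [qInt_two]
  rcases Int.units_eq_one_or ε with rfl | rfl <;>
    simp [qInt, zpow_add₀ h0, zpow_sub₀ h0, h2, mul_add, mul_sub] <;> field_simp <;> ring

theorem B1_smul_loweringPow (hw : IsWeightVector d e k w) (h : B1 • w = 0) (ε : ℤˣ) (m : ℕ) :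
    B1 • loweringPow ε k (m + 1) • w = qInt (m + 1) • loweringPow ε k m •
      (Z • w + (q ^ (-(d - e)) * qInt k - qInt (k - ε * (d - e - 2 * m))) • w) := by
  have hε : (ε : ℤ) * ε = 1 := by rw [← Units.val_mul, Int.units_mul_self, Units.val_one]
  induction m with
  | zero =>
    have hcoeff := B1_smul_loweringPow_coeff ε (d - e) k 0
    rw [qInt_zero] at hcoeff
    simp only [loweringPow, Nat.cast_zero, mul_zero, add_zero, sub_zero, mul_one, one_smul]
    rw [B1_smul_lowering_smul, h, smul_zero, H_smul hw.Dd_smul hw.D1_smul]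
    generalize Z • w = z
    match_scalars
    · rw [zero_add, qInt_one, one_mul]
    · simp only [mul_zero, sub_zero, add_zero] at hcoeff
      linear_combination hcoeff
  | succ m ih =>
    have hw' := hw.loweringPow_smul ε (m + 1)
    have hcoeff := B1_smul_loweringPow_coeff ε (d - e) k (m + 1)
    rw [loweringPow, mul_smul, B1_smul_lowering_smul, ih, smul_scalar_smul,
      Nat.cast_succ, mul_add (ε : ℤ), mul_one, ← add_assoc, add_sub_cancel_right,
      ← mul_smul (lowering _ _), ← loweringPow, hw.Z_smul_loweringPow,
      H_smul hw'.Dd_smul hw'.D1_smul]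
    simp only [← smul_scalar_smul (loweringPow ε k (m + 1)), ← smul_add]
    congr 1
    push_cast
    rw [show d - e - 2 * ((m : ℤ) + 1) + 2 = d - e - 2 * m by ring] at hcoeff
    rw [show d - ((m : ℤ) + 1) - (e + (m + 1)) = d - e - 2 * (m + 1) by ring,
      show (ε : ℤ) * (k + ε * m + ε) = ε * k + (m + 1) by linear_combination (m + 1 : ℤ) * hε]
    generalize Z • w = z
    match_scalars
    · linear_combination -qInt_succ (m + 1)
    · linear_combination hcoeff

end IsWeightVector

end WeightVectors

/-! ### Weight spaces -/

theorem iSupIndep_inf {α ι κ : Type*} [CompleteLattice α] [IsModularLattice α] {s : ι → α}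
    {t : κ → α} (hs : iSupIndep s) (ht : iSupIndep t) :
    iSupIndep fun p : ι × κ => s p.1 ⊓ t p.2 := by
  rintro ⟨i, j⟩
  let b := ⨆ i' ≠ i, s i'
  let c := ⨆ j' ≠ j, t j'
  have hle : ⨆ p ≠ (i, j), s p.1 ⊓ t p.2 ≤ b ⊔ s i ⊓ c := by
    refine iSup₂_le fun p hp => ?_
    by_cases hi : p.1 = i
    · have hj : p.2 ≠ j := fun hj => hp (Prod.ext hi hj)
      exact le_sup_of_le_right (hi ▸ inf_le_inf_left _ (le_iSup₂_of_le p.2 hj le_rfl))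
    · exact le_sup_of_le_left (inf_le_left.trans (le_iSup₂_of_le p.1 hi le_rfl))
  have hmod : s i ⊓ (b ⊔ s i ⊓ c) = s i ⊓ c := by
    rw [← inf_sup_assoc_of_le b inf_le_left, (hs i).eq_bot, bot_sup_eq]
  refine disjoint_iff_inf_le.mpr ((inf_le_inf_left _ hle).trans ?_)
  calc s i ⊓ t j ⊓ (b ⊔ s i ⊓ c) = t j ⊓ (s i ⊓ c) := by rw [inf_comm (s i), inf_assoc, hmod]
    _ ≤ t j ⊓ c := inf_le_inf_left _ inf_le_right
    _ ≤ ⊥ := (ht j).le_bot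

theorem eq_span_image_of_iSupIndep {R M ι κ : Type*} [Ring R] [AddCommGroup M] [Module R M]
    {p : κ → Submodule R M} (hp : iSupIndep p) {x : ι → M} {f : ι → κ}
    (hx : ∀ i, x i ∈ p (f i)) (htop : Submodule.span R (Set.range x) = ⊤) (k : κ) :
    p k = Submodule.span R (x '' {i | f i = k}) := by
  have hle : Submodule.span R (x '' {i | f i = k}) ≤ p k := by
    rw [Submodule.span_le]
    rintro _ ⟨i, rfl, rfl⟩
    exact hx i
  have hsup : Submodule.span R (x '' {i | f i = k}) ⊔ ⨆ k' ≠ k, p k' = ⊤ := by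
    rw [← top_le_iff, ← htop, Submodule.span_le]
    rintro _ ⟨i, rfl⟩
    by_cases hi : f i = k
    · exact Submodule.mem_sup_left (Submodule.subset_span ⟨i, hi, rfl⟩)
    · exact Submodule.mem_sup_right
        (Submodule.mem_iSup_of_mem _ (Submodule.mem_iSup_of_mem hi (hx i)))
  refine (eq_of_le_of_inf_le_of_sup_le (z := ⨆ k' ≠ k, p k') hle ?_ ?_).symm
  · exact (hp k).le_bot.trans bot_le
  · exact le_top.trans hsup.ge

theorem mem_of_sum_mem_of_mem_eigenspace {K M : Type*} [Field K] [AddCommGroup M] [Module K M]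
    {f : Module.End K M} {N : Submodule K M} (hN : ∀ x ∈ N, f x ∈ N) {s : Finset K} {y : K → M}
    (hy : ∀ c ∈ s, y c ∈ f.eigenspace c) (hs : ∑ c ∈ s, y c ∈ N) : ∀ c ∈ s, y c ∈ N := by
  classical
  induction s using Finset.induction generalizing y with
  | empty => simp
  | insert a s ha ih =>
    have hfy (c : K) (hc : c ∈ insert a s) : f (y c) = c • y c :=
      Module.End.mem_eigenspace_iff.mp (hy c hc)
    have hsum : ∑ c ∈ s, (c - a) • y c ∈ N := by
      have h : f (∑ c ∈ insert a s, y c) - a • ∑ c ∈ insert a s, y c =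
          ∑ c ∈ s, (c - a) • y c := by
        rw [map_sum, Finset.smul_sum, ← Finset.sum_sub_distrib, Finset.sum_insert ha,
          hfy a (Finset.mem_insert_self a s), sub_self, zero_add]
        exact Finset.sum_congr rfl fun c hc => by
          rw [hfy c (Finset.mem_insert_of_mem hc), sub_smul]
      exact h ▸ N.sub_mem (hN _ hs) (N.smul_mem a hs)
    have hmem (c : K) (hc : c ∈ s) : y c ∈ N := by
      have hca : c - a ≠ 0 := sub_ne_zero.mpr fun h => ha (h ▸ hc)
      refine (N.smul_mem_iff hca).mp (ih (fun c hc => ?_) hsum c hc)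
      exact Submodule.smul_mem _ _ (hy c (Finset.mem_insert_of_mem hc))
    rw [Finset.sum_insert ha] at hs
    exact Finset.forall_mem_insert _ _ _ |>.mpr
      ⟨(N.add_mem_iff_left (N.sum_mem hmem)).mp hs, hmem⟩

section

variable {V : Type*} [AddCommGroup V] [Module Cq V] [Module U V] [IsScalarTower Cq U V]

theorem mem_eigenspace_act {u : U} {c : Cq} {x : V} :
    x ∈ (act V u).eigenspace c ↔ u • x = c • x :=
  Module.End.mem_eigenspace_iff

theorem mem_weightSpace {w : Cq × Cq × Cq × Cq} {x : V} : x ∈ weightSpace V w ↔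
    Dd • x = w.1 • x ∧ D1 • x = w.2.1 • x ∧ B0 • x = w.2.2.1 • x ∧ Z • x = w.2.2.2 • x := by
  simp only [weightSpace, Submodule.mem_inf, mem_eigenspace_act, and_assoc]

variable (V) in
theorem iSupIndep_weightSpace : iSupIndep (weightSpace V) := by
  have h := iSupIndep_inf (act V Dd).eigenspaces_iSupIndep
    (iSupIndep_inf (act V D1).eigenspaces_iSupIndep
      (iSupIndep_inf (act V B0).eigenspaces_iSupIndep (act V Z).eigenspaces_iSupIndep))
  simp only [← inf_assoc] at h
  exact h

theorem isSumOfWeightLines_of_span {ι : Type*} {x : ι → V} {f : ι → Cq × Cq × Cq × Cq}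
    (hf : Function.Injective f) (hx : ∀ i, x i ∈ weightSpace V (f i))
    (htop : Submodule.span Cq (Set.range x) = ⊤) : IsSumOfWeightLines V where
  independent := iSupIndep_weightSpace V
  iSup_eq_top := by
    rw [← top_le_iff, ← htop, Submodule.span_le]
    rintro _ ⟨i, rfl⟩
    exact Submodule.mem_iSup_of_mem (f i) (hx i)
  finrank_eq_one w hw := by
    have hspan := eq_span_image_of_iSupIndep (iSupIndep_weightSpace V) hx htop w
    obtain ⟨i, rfl⟩ : {i | f i = w}.Nonempty := by
      by_contra! hi
      exact hw (by rw [hspan, hi, Set.image_empty, Submodule.span_empty])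
    have hfib : {j | f j = f i} = {i} := Set.ext fun j => hf.eq_iff
    rw [hfib, Set.image_singleton] at hspan
    rw [hspan] at hw ⊢
    exact finrank_span_singleton fun h => hw (Submodule.span_singleton_eq_bot.mpr h)

theorem diagonalizableIn_of_span {ι : Type*} {x : ι → V} {u : U} {f : ι → Cq} {S : Set Cq}
    (hf : ∀ i, f i ∈ S) (hx : ∀ i, u • x i = f i • x i)
    (htop : Submodule.span Cq (Set.range x) = ⊤) : DiagonalizableIn V u S := by
  rw [DiagonalizableIn, ← top_le_iff, ← htop, Submodule.span_le]
  rintro _ ⟨i, rfl⟩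
  exact Submodule.mem_iSup_of_mem _
    (Submodule.mem_iSup_of_mem (hf i) (mem_eigenspace_act.mpr (hx i)))

end

/-! ### Modules generated by a maximal vector -/

section Lowered

variable {V : Type*} [AddCommGroup V] [Module U V]

/-- The vector of `B0`-eigenvalue `[n + p.1 - p.2]` obtained from a vector `v` of `B0`-eigenvalue
`[n]` by `p.1` lowering operators with `ε = 1` followed by `p.2` ones with `ε = -1`. -/
def lowered (n : ℤ) (v : V) (p : ℕ × ℕ) : V :=
  loweringPow (-1) (n + p.1) p.2 • loweringPow 1 n p.1 • v

theorem lowered_zero (n : ℤ) (v : V) : lowered n v 0 = v := by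
  simp [lowered, loweringPow]

theorem lowering_neg_one_smul_lowered (n : ℤ) (v : V) (a b : ℕ) :
    lowering (-1) (n + a - b) • lowered n v (a, b) = lowered n v (a, b + 1) := by
  rw [lowered, lowered, loweringPow, mul_smul, Units.val_neg, Units.val_one, neg_one_mul,
    ← sub_eq_add_neg]

theorem lowering_one_smul_lowered (n : ℤ) (v : V) (a b : ℕ) :
    lowering 1 (n + a - b) • lowered n v (a, b) = lowered n v (a + 1, b) := by
  induction b with
  | zero => simp [lowered, loweringPow, mul_smul]
  | succ b ih =>
    have hk : n + (a : ℤ) - (b + 1 : ℕ) = n + a - b - 1 := by push_cast; ring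
    have hk' : n + (a : ℤ) - b + 1 = n + (a + 1 : ℕ) - b := by push_cast; ring
    rw [← lowering_neg_one_smul_lowered, ← lowering_neg_one_smul_lowered, ← ih, ← mul_smul,
      ← mul_smul, hk, ← lowering_neg_one_mul_lowering_one, hk']

end Lowered

section

variable {V : Type*} [AddCommGroup V] [Module Cq V] [Module U V] [IsScalarTower Cq U V]

theorem smul_mem_of_forall_cls {T : Submodule Cq V} (h : ∀ g, ∀ x ∈ T, cls g • x ∈ T) (u : U) :
    ∀ x ∈ T, u • x ∈ T := by
  obtain ⟨a, rfl⟩ := RingQuot.mkAlgHom_surjective Cq Rel u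
  induction a using FreeAlgebra.induction with
  | grade0 r =>
    intro x hx
    rw [AlgHom.commutes, algebraMap_smul]
    exact T.smul_mem r hx
  | grade1 g => exact h g
  | mul a b ha hb =>
    intro x hx
    rw [map_mul, mul_smul]
    exact ha _ (hb _ hx)
  | add a b ha hb =>
    intro x hx
    rw [map_add, add_smul]
    exact T.add_mem (ha _ hx) (hb _ hx)

theorem smul_mem_span {s : Set V} {u : U} (h : ∀ x ∈ s, u • x ∈ Submodule.span Cq s) :
    ∀ x ∈ Submodule.span Cq s, u • x ∈ Submodule.span Cq s := by
  have hle : Submodule.span Cq s ≤ (Submodule.span Cq s).comap (act V u) := Submodule.span_le.mpr h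
  exact fun x hx => hle hx

theorem Bm1_smul_eq (k : ℤ) (x : V) :
    Bm1 • x = (qCosh k)⁻¹ • (lowering 1 k • x - lowering (-1) k • x) := by
  rw [eq_inv_smul_iff₀ (qCosh_ne_zero k), lowering, lowering, add_smul, add_smul, smul_assoc,
    smul_assoc, qCosh]
  generalize Y • x = y
  generalize Bm1 • x = f
  match_scalars <;> simp
  ring

theorem Y_smul_eq (k : ℤ) (x : V) :
    Y • x = (qCosh k)⁻¹ • (q ^ k • lowering 1 k • x + q ^ (-k) • lowering (-1) k • x) := by
  have h0 := zpow_ne_zero k q_ne_zero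
  rw [eq_inv_smul_iff₀ (qCosh_ne_zero k), lowering, lowering, add_smul, add_smul, smul_assoc,
    smul_assoc, qCosh]
  generalize Y • x = y
  generalize Bm1 • x = f
  match_scalars <;> simp [h0]

theorem lowering_smul_mem {T : Submodule Cq V} (hBm1 : ∀ x ∈ T, Bm1 • x ∈ T)
    (hY : ∀ x ∈ T, Y • x ∈ T) (ε : ℤˣ) (k : ℤ) {x : V} (hx : x ∈ T) : lowering ε k • x ∈ T := by
  rw [lowering, add_smul, smul_assoc]
  exact T.add_mem (hY x hx) (T.smul_mem _ (hBm1 x hx))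

namespace IsMaximalVector

variable {d e n : ℤ} {ζ : Cq} {v : V}

theorem of_B1_smul (hv0 : v ≠ 0) (hv : IsWeightVector d e n v) (hB1 : B1 • v = 0)
    (hZ : Z • v = ζ • v) : IsMaximalVector V d e (qInt n) ζ v where
  ne_zero := hv0
  mem_weightSpace := QSP.mem_weightSpace.mpr ⟨hv.Dd_smul, hv.D1_smul, hv.B0_smul, hZ⟩
  B1_smul := hB1
  X_smul := by
    rw [X, qComm, sub_smul, smul_assoc, mul_smul, mul_smul, hB1, hv.B0_smul, smul_comm B1, hB1]
    simp only [smul_zero, sub_zero]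

theorem isWeightVector (hv : IsMaximalVector V d e (qInt n) ζ v) : IsWeightVector d e n v :=
  let ⟨hDd, hD1, hB0, _⟩ := QSP.mem_weightSpace.mp hv.mem_weightSpace
  ⟨hDd, hD1, hB0⟩

theorem Z_smul (hv : IsMaximalVector V d e (qInt n) ζ v) : Z • v = ζ • v :=
  (QSP.mem_weightSpace.mp hv.mem_weightSpace).2.2.2

theorem isWeightVector_lowered (hv : IsMaximalVector V d e (qInt n) ζ v) (p : ℕ × ℕ) :
    IsWeightVector (d - (p.1 + p.2)) (e + (p.1 + p.2)) (n + p.1 - p.2) (lowered n v p) := by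
  have h1 := hv.isWeightVector.loweringPow_smul 1 p.1
  rw [Units.val_one, one_mul] at h1
  convert h1.loweringPow_smul (-1) p.2 using 1
  · ring
  · ring
  · rw [Units.val_neg, Units.val_one, neg_one_mul, sub_eq_add_neg]
  · rfl

theorem exists_Z_smul_lowered (hv : IsMaximalVector V d e (qInt n) ζ v) (p : ℕ × ℕ) :
    ∃ z : Cq, Z • lowered n v p = z • lowered n v p := by
  have hstep {d e k : ℤ} {w : V} (hw : IsWeightVector d e k w) (ε : ℤˣ) (m : ℕ) {z : Cq}
      (hz : Z • w = z • w) : ∃ z' : Cq, Z • loweringPow ε k m • w = z' • loweringPow ε k m • w := by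
    rw [hw.Z_smul_loweringPow, hz, smul_smul, ← sub_smul, smul_scalar_smul]
    exact ⟨_, rfl⟩
  have h1 := hv.isWeightVector.loweringPow_smul 1 p.1
  rw [Units.val_one, one_mul] at h1
  obtain ⟨z, hz⟩ := hstep hv.isWeightVector 1 p.1 hv.Z_smul
  exact hstep h1 (-1) p.2 hz

theorem B1_smul_lowered_mem (hv : IsMaximalVector V d e (qInt n) ζ v) {T : Submodule Cq V}
    (hT : ∀ p, lowered n v p ∈ T) (hBm1 : ∀ x ∈ T, Bm1 • x ∈ T) (hY : ∀ x ∈ T, Y • x ∈ T)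
    (p : ℕ × ℕ) : B1 • lowered n v p ∈ T := by
  have hstep (ε : ℤˣ) (k : ℤ) (p : ℕ × ℕ) (h : B1 • lowered n v p ∈ T) :
      B1 • lowering ε k • lowered n v p ∈ T := by
    have hp := hv.isWeightVector_lowered p
    obtain ⟨z, hz⟩ := hv.exists_Z_smul_lowered p
    rw [B1_smul_lowering_smul, hz, H_smul hp.Dd_smul hp.D1_smul]
    exact T.add_mem (T.add_mem (T.smul_mem _ (lowering_smul_mem hBm1 hY _ _ h))
      (T.smul_mem _ (hT p))) (T.smul_mem _ (T.smul_mem _ (hT p)))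
  obtain ⟨a, b⟩ := p
  induction b with
  | zero =>
    induction a with
    | zero =>
      rw [show ((0, 0) : ℕ × ℕ) = 0 from rfl, lowered_zero, hv.B1_smul]
      exact T.zero_mem
    | succ a ih =>
      rw [← lowering_one_smul_lowered]
      exact hstep _ _ _ ih
  | succ b ih =>
    rw [← lowering_neg_one_smul_lowered]
    exact hstep _ _ _ ih

theorem span_lowered_eq_top (hv : IsMaximalVector V d e (qInt n) ζ v)
    (hgen : Submodule.span U {v} = ⊤) : Submodule.span Cq (Set.range (lowered n v)) = ⊤ := by
  set T := Submodule.span Cq (Set.range (lowered n v))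
  have hT (p : ℕ × ℕ) : lowered n v p ∈ T := Submodule.subset_span ⟨p, rfl⟩
  have hspan {u : U} (h : ∀ p, u • lowered n v p ∈ T) : ∀ x ∈ T, u • x ∈ T :=
    smul_mem_span (Set.forall_mem_range.mpr h)
  have heigen {u : U} {c : ℕ × ℕ → Cq} (h : ∀ p, u • lowered n v p = c p • lowered n v p) :
      ∀ x ∈ T, u • x ∈ T :=
    hspan fun p => h p ▸ T.smul_mem (c p) (hT p)
  have hwt := hv.isWeightVector_lowered
  have hBm1 : ∀ x ∈ T, Bm1 • x ∈ T := hspan fun p => by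
    rw [Bm1_smul_eq (n + p.1 - p.2), lowering_one_smul_lowered, lowering_neg_one_smul_lowered]
    exact T.smul_mem _ (T.sub_mem (hT _) (hT _))
  have hY : ∀ x ∈ T, Y • x ∈ T := hspan fun p => by
    rw [Y_smul_eq (n + p.1 - p.2), lowering_one_smul_lowered, lowering_neg_one_smul_lowered]
    exact T.smul_mem _ (T.add_mem (T.smul_mem _ (hT _)) (T.smul_mem _ (hT _)))
  have hU := smul_mem_of_forall_cls (T := T) fun
    | .B0 => heigen fun p => (hwt p).B0_smul
    | .B1 => hspan (hv.B1_smul_lowered_mem hT hBm1 hY)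
    | .Bm1 => hBm1
    | .Dd => heigen fun p => (hwt p).Dd_smul
    | .DdInv => heigen fun p =>
        units_inv_smul (a := DdUnit) (zpow_ne_zero _ q_ne_zero) (hwt p).Dd_smul
    | .D1 => heigen fun p => (hwt p).D1_smul
    | .D1Inv => heigen fun p =>
        units_inv_smul (a := D1Unit) (zpow_ne_zero _ q_ne_zero) (hwt p).D1_smul
  refine Submodule.eq_top_iff'.mpr fun x => ?_
  obtain ⟨u, rfl⟩ := Submodule.mem_span_singleton.mp (hgen ▸ Submodule.mem_top : x ∈ _)
  exact hU u v (lowered_zero n v ▸ hT 0)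

theorem isSumOfWeightLines (hv : IsMaximalVector V d e (qInt n) ζ v)
    (hgen : Submodule.span U {v} = ⊤) : IsSumOfWeightLines V := by
  choose z hz using hv.exists_Z_smul_lowered
  refine isSumOfWeightLines_of_span (f := fun p =>
    (q ^ (d - (p.1 + p.2) : ℤ), q ^ (e + (p.1 + p.2) : ℤ), qInt (n + p.1 - p.2), z p))
    (fun p p' h => ?_) (fun p => ?_) (hv.span_lowered_eq_top hgen)
  · simp only [Prod.mk.injEq] at h
    have h1 := q_zpow_injective h.1
    have h2 := qInt_injective h.2.2.1
    ext <;> omega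
  · have h := hv.isWeightVector_lowered p
    exact QSP.mem_weightSpace.mpr ⟨h.Dd_smul, h.D1_smul, h.B0_smul, hz p⟩

theorem isRational [Module.Finite Cq V] (hv : IsMaximalVector V d e (qInt n) ζ v)
    (hgen : Submodule.span U {v} = ⊤) : IsRational V where
  finite := inferInstance
  diag_B0 := diagonalizableIn_of_span (fun _ => ⟨_, rfl⟩)
    (fun p => (hv.isWeightVector_lowered p).B0_smul) (hv.span_lowered_eq_top hgen)
  diag_Dd := diagonalizableIn_of_span (fun _ => ⟨_, rfl⟩)
    (fun p => (hv.isWeightVector_lowered p).Dd_smul) (hv.span_lowered_eq_top hgen)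
  diag_D1 := diagonalizableIn_of_span (fun _ => ⟨_, rfl⟩)
    (fun p => (hv.isWeightVector_lowered p).D1_smul) (hv.span_lowered_eq_top hgen)

theorem iSup_eigenspace_Dd (hv : IsMaximalVector V d e (qInt n) ζ v)
    (hgen : Submodule.span U {v} = ⊤) : ⨆ c, (act V Dd).eigenspace c = ⊤ := by
  rw [← top_le_iff, ← hv.span_lowered_eq_top hgen, Submodule.span_le]
  rintro _ ⟨p, rfl⟩
  exact Submodule.mem_iSup_of_mem _ (mem_eigenspace_act.mpr (hv.isWeightVector_lowered p).Dd_smul)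

theorem eigenspace_Dd (hv : IsMaximalVector V d e (qInt n) ζ v) (hgen : Submodule.span U {v} = ⊤)
    (m : ℤ) : (act V Dd).eigenspace (q ^ m) =
      Submodule.span Cq (lowered n v '' {p | d - (p.1 + p.2) = m}) := by
  have h := eq_span_image_of_iSupIndep (act V Dd).eigenspaces_iSupIndep
    (fun p => mem_eigenspace_act.mpr (hv.isWeightVector_lowered p).Dd_smul)
    (hv.span_lowered_eq_top hgen) (q ^ m)
  simpa only [q_zpow_injective.eq_iff] using h

theorem eigenspace_Dd_top (hv : IsMaximalVector V d e (qInt n) ζ v)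
    (hgen : Submodule.span U {v} = ⊤) :
    (act V Dd).eigenspace (q ^ d) = Submodule.span Cq {v} := by
  have h0 : {p : ℕ × ℕ | d - (p.1 + p.2) = d} = {0} := by
    ext p
    simp only [Set.mem_ofPred_eq, Set.mem_singleton_iff, Prod.ext_iff, Prod.fst_zero, Prod.snd_zero]
    omega
  rw [hv.eigenspace_Dd hgen, h0, Set.image_singleton, lowered_zero]

theorem le_of_Dd_smul (hv : IsMaximalVector V d e (qInt n) ζ v) (hgen : Submodule.span U {v} = ⊤)
    {m : ℤ} {x : V} (hx0 : x ≠ 0) (hx : Dd • x = q ^ m • x) : m ≤ d := by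
  by_contra! hm
  have h0 : {p : ℕ × ℕ | d - (p.1 + p.2) = m} = ∅ := by
    refine Set.eq_empty_of_forall_notMem fun p hp => ?_
    have hp' : d - (p.1 + p.2) = m := hp
    omega
  have hbot := hv.eigenspace_Dd hgen m
  rw [h0, Set.image_empty, Submodule.span_empty] at hbot
  exact hx0 ((Submodule.mem_bot Cq).mp (hbot ▸ mem_eigenspace_act.mpr hx))

theorem sSup_setOf_ne_top_ne_top (hv : IsMaximalVector V d e (qInt n) ζ v)
    (hgen : Submodule.span U {v} = ⊤) : sSup {N : Submodule U V | N ≠ ⊤} ≠ ⊤ := by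
  -- Every proper submodule lies in the sum `S` of the lower eigenspaces of `Dd`.
  let S := ⨆ c ≠ q ^ d, (act V Dd).eigenspace c
  have hvS : v ∉ S := fun h => hv.ne_zero <| (Submodule.mem_bot Cq).mp <|
    ((act V Dd).eigenspaces_iSupIndep (q ^ d)).le_bot
      ⟨mem_eigenspace_act.mpr hv.isWeightVector.Dd_smul, h⟩
  have hle {N : Submodule U V} (hN : N ≠ ⊤) {x : V} (hx : x ∈ N) : x ∈ S := by
    obtain ⟨y, hy, rfl⟩ := (Submodule.mem_iSup_iff_exists_finsupp _ _).mp
      (hv.iSup_eigenspace_Dd hgen ▸ Submodule.mem_top : x ∈ ⨆ c, (act V Dd).eigenspace c)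
    have hyN := mem_of_sum_mem_of_mem_eigenspace (N := N.restrictScalars Cq)
      (fun x hx => N.smul_mem Dd hx) (fun c _ => hy c) hx
    refine S.sum_mem fun c hc => Submodule.mem_iSup_of_mem c (Submodule.mem_iSup_of_mem ?_ (hy c))
    rintro rfl
    obtain ⟨a, ha⟩ := Submodule.mem_span_singleton.mp (hv.eigenspace_Dd_top hgen ▸ hy (q ^ d))
    have ha0 : a ≠ 0 := by
      rintro rfl
      exact Finsupp.mem_support_iff.mp hc (by rw [← ha, zero_smul])
    have hvN : v ∈ N.restrictScalars Cq := (Submodule.smul_mem_iff _ ha0).mp (ha ▸ hyN _ hc)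
    exact hN (top_le_iff.mp (hgen ▸ (Submodule.span_singleton_le_iff_mem v N).mpr hvN))
  refine fun htop => hvS ?_
  have hv_mem : v ∈ ⨆ N : {N : Submodule U V | N ≠ ⊤}, N.1 := by
    rw [← sSup_eq_iSup', htop]
    exact Submodule.mem_top
  exact Submodule.iSup_induction _ (motive := (· ∈ S)) hv_mem (fun N x hx => hle N.2 hx) S.zero_mem
    fun _ _ => S.add_mem

end IsMaximalVector

end

/-! ### Rational modules -/

section

variable {V : Type*} [AddCommGroup V] [Module Cq V] [Module U V] [IsScalarTower Cq U V]

theorem DiagonalizableIn.exists_inf_eigenspace_ne_bot [Module.Finite Cq V] {u : U} {S : Set Cq}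
    (h : DiagonalizableIn V u S) {p : Submodule Cq V} (hp : p ≠ ⊥) (hu : ∀ x ∈ p, u • x ∈ p) :
    ∃ c ∈ S, p ⊓ (act V u).eigenspace c ≠ ⊥ := by
  contrapose! hp
  have htop : ⨆ c, (act V u).eigenspace c = ⊤ :=
    top_le_iff.mp (h ▸ iSup₂_le fun c _ => le_iSup (act V u).eigenspace c)
  rw [Submodule.eq_iSup_inf_genEigenspace (f := act V u) (k := 1) hu htop, iSup_eq_bot]
  intro c
  by_cases hc : c ∈ S
  · exact hp c hc
  · have hd : Disjoint ((act V u).eigenspace c) (⨆ c ∈ S, (act V u).eigenspace c) :=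
      (act V u).eigenspaces_iSupIndep.disjoint_biSup hc
    rw [show ⨆ c ∈ S, (act V u).eigenspace c = ⊤ from h, disjoint_top] at hd
    exact le_bot_iff.mp (inf_le_right.trans hd.le)

variable (V) in
theorem finite_hasEigenvalue_Dd [Module.Finite Cq V] :
    {m : ℤ | (act V Dd).HasEigenvalue (q ^ m)}.Finite :=
  (act V Dd).finite_hasEigenvalue.preimage q_zpow_injective.injOn

theorem hasEigenvalue_Dd {m : ℤ} {x : V} (hx0 : x ≠ 0) (hx : Dd • x = q ^ m • x) :
    (act V Dd).HasEigenvalue (q ^ m) :=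
  Module.End.hasEigenvalue_of_hasEigenvector ⟨mem_eigenspace_act.mpr hx, hx0⟩

theorem mem_inf_eigenspace_act {d e k : ℤ} {x : V} :
    x ∈ (act V Dd).eigenspace (q ^ d) ⊓ (act V D1).eigenspace (q ^ e) ⊓
      (act V B0).eigenspace (qInt k) ↔ IsWeightVector d e k x := by
  simp only [Submodule.mem_inf, mem_eigenspace_act]
  exact ⟨fun h => ⟨h.1.1, h.1.2, h.2⟩, fun h => ⟨⟨h.Dd_smul, h.D1_smul⟩, h.B0_smul⟩⟩

variable (V) in
theorem exists_loweringPow_smul_eq_zero [Module.Finite Cq V] (d : ℤ) :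
    ∃ M : ℕ, ∀ (ε : ℤˣ) (e k : ℤ) (x : V), IsWeightVector d e k x →
      loweringPow ε k M • x = 0 := by
  obtain ⟨b, hb⟩ := (finite_hasEigenvalue_Dd V).bddBelow
  refine ⟨(d - b + 1).toNat, fun ε e k x hx => ?_⟩
  by_contra h0
  have hle := hb (hasEigenvalue_Dd h0 (hx.loweringPow_smul ε _).Dd_smul)
  omega

theorem exists_Z_smul_eq [Module.Finite Cq V] (ε : ℤˣ) {d e n : ℤ} {W : Submodule Cq V}
    (hW : W ≠ ⊥) (hwt : ∀ x ∈ W, IsWeightVector d e n x) (hB1 : ∀ x ∈ W, B1 • x = 0)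
    (hZ : ∀ x ∈ W, Z • x ∈ W) :
    ∃ m : ℕ, ∃ x ∈ W, x ≠ 0 ∧
      Z • x = (qInt (n - ε * (d - e - 2 * m)) - q ^ (-(d - e)) * qInt n) • x := by
  obtain ⟨M, hM⟩ := exists_loweringPow_smul_eq_zero V d
  obtain ⟨m, hne, heq⟩ : ∃ m, (¬ ∀ x ∈ W, loweringPow ε n m • x = 0) ∧
      ∀ x ∈ W, loweringPow ε n (m + 1) • x = 0 := by
    refine Nat.exists_not_and_succ_of_not_zero_of_exists (fun h => hW ?_)
      ⟨M, fun x hx => hM ε e n x (hwt x hx)⟩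
    exact (Submodule.eq_bot_iff W).mpr fun x hx => by simpa [loweringPow] using h x hx
  set a := q ^ (-(d - e)) * qInt n - qInt (n - ε * (d - e - 2 * m)) with ha
  let S : W →ₗ[Cq] W :=
    (act V Z + a • 1).restrict fun x hx => W.add_mem (hZ x hx) (W.smul_mem a hx)
  have hS (x : W) : (S x : V) = Z • (x : V) + a • (x : V) := rfl
  -- The `m`-th power of the lowering operator kills the image of `S`, but not all of `W`.
  have hS_notsurj : ¬ Function.Surjective S := fun hsurj => hne fun y hy => by
    obtain ⟨x, hx⟩ := hsurj ⟨y, hy⟩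
    have h := (hwt x x.2).B1_smul_loweringPow (hB1 x x.2) ε m
    rw [heq x x.2, smul_zero, ← ha, ← hS, hx] at h
    exact (smul_eq_zero.mp h.symm).resolve_left (qInt_ne_zero (by omega))
  rw [← LinearMap.injective_iff_surjective, ← LinearMap.ker_eq_bot] at hS_notsurj
  obtain ⟨x, hx, hx0⟩ := Submodule.exists_mem_ne_zero_of_ne_bot hS_notsurj
  refine ⟨m, x, x.2, fun h => hx0 (Subtype.ext h), ?_⟩
  have hSx : Z • (x : V) + a • (x : V) = 0 := congrArg Subtype.val hx
  rw [eq_neg_of_add_eq_zero_left hSx, ← neg_smul, ha, neg_sub]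

theorem IsMaximalVector.exists_zeta_eq [Module.Finite Cq V] {d e n : ℤ} {ζ : Cq} {v : V}
    (hv : IsMaximalVector V d e (qInt n) ζ v) (ε : ℤˣ) :
    ∃ m : ℕ, ζ = qInt (n - ε * (d - e - 2 * m)) - q ^ (-(d - e)) * qInt n := by
  have hvW : v ∈ (act V Dd).eigenspace (q ^ d) ⊓ (act V D1).eigenspace (q ^ e) ⊓
      (act V B0).eigenspace (qInt n) := mem_inf_eigenspace_act.mpr hv.isWeightVector
  have hwt (x : V) (hx : x ∈ Submodule.span Cq {v}) : IsWeightVector d e n x :=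
    mem_inf_eigenspace_act.mp ((Submodule.span_singleton_le_iff_mem v _).mpr hvW hx)
  obtain ⟨m, x, hx, hx0, hZx⟩ := exists_Z_smul_eq ε (W := Submodule.span Cq {v})
    (fun h => hv.ne_zero (Submodule.span_singleton_eq_bot.mp h)) hwt
    (fun x hx => by
      obtain ⟨c, rfl⟩ := Submodule.mem_span_singleton.mp hx
      rw [smul_scalar_smul, hv.B1_smul, smul_zero])
    (smul_mem_span <| by
      rintro _ rfl
      exact hv.Z_smul ▸ Submodule.smul_mem _ ζ (Submodule.mem_span_singleton_self _))
  obtain ⟨c, rfl⟩ := Submodule.mem_span_singleton.mp hx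
  rw [smul_scalar_smul, hv.Z_smul, smul_comm] at hZx
  exact ⟨m, smul_left_injective Cq hx0 hZx⟩

theorem IsMaximalVector.exists_eq_domZeta [Module.Finite Cq V] {d e n : ℤ} {ζ : Cq} {v : V}
    (hv : IsMaximalVector V d e (qInt n) ζ v) :
    ∃ i : ℤ, 0 ≤ i ∧ i ≤ d - e ∧ ζ = domZeta d e n i := by
  obtain ⟨j, hj⟩ := hv.exists_zeta_eq 1
  obtain ⟨i, hi⟩ := hv.exists_zeta_eq (-1)
  simp only [Units.val_neg, Units.val_one] at hi hj
  have hij := qInt_injective (sub_left_injective (hi.symm.trans hj))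
  refine ⟨i, by omega, by omega, hi.trans ?_⟩
  rw [domZeta, show n - -1 * (d - e - 2 * i) = n + (d - e) - 2 * i by ring]

theorem IsRational.exists_hasEigenvalue_Dd [Nontrivial V] (hV : IsRational V) :
    ∃ d : ℤ, (act V Dd).HasEigenvalue (q ^ d) ∧
      ∀ m : ℤ, (act V Dd).HasEigenvalue (q ^ m) → m ≤ d := by
  have := hV.finite
  obtain ⟨_, ⟨d₀, rfl⟩, hd₀⟩ :=
    hV.diag_Dd.exists_inf_eigenspace_ne_bot top_ne_bot fun _ _ => Submodule.mem_top
  rw [top_inf_eq] at hd₀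
  exact Set.exists_max_image _ id (finite_hasEigenvalue_Dd V) ⟨d₀, hd₀⟩

theorem IsRational.exists_isMaximalVector [Nontrivial V] (hV : IsRational V) :
    ∃ (d e n i : ℤ) (v : V), 0 ≤ i ∧ i ≤ d - e ∧
      IsMaximalVector V d e (qInt n) (domZeta d e n i) v := by
  have := hV.finite
  obtain ⟨d, hd, hmax⟩ := hV.exists_hasEigenvalue_Dd
  obtain ⟨_, ⟨e, rfl⟩, hde⟩ := hV.diag_D1.exists_inf_eigenspace_ne_bot hd fun x hx =>
    mem_eigenspace_act.mpr (smul_smul_of_commute commute_Dd_D1 (mem_eigenspace_act.mp hx))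
  obtain ⟨_, ⟨n, rfl⟩, hW⟩ := hV.diag_B0.exists_inf_eigenspace_ne_bot hde fun x hx => by
    simp only [Submodule.mem_inf, mem_eigenspace_act] at hx ⊢
    exact ⟨smul_smul_of_commute commute_B0_Dd.symm hx.1,
      smul_smul_of_commute commute_B0_D1.symm hx.2⟩
  have hB1 (x : V) (hx : IsWeightVector d e n x) : B1 • x = 0 := by
    by_contra hx0
    have hDd := smul_smul_of_semiconjBy semiconjBy_Dd_B1 hx.Dd_smul
    rw [mul_comm, ← zpow_add_one₀ q_ne_zero] at hDd
    have hle := hmax _ (hasEigenvalue_Dd hx0 hDd)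
    omega
  obtain ⟨m, v, hvW, hv0, hZv⟩ := exists_Z_smul_eq 1 hW
    (fun x hx => mem_inf_eigenspace_act.mp hx) (fun x hx => hB1 x (mem_inf_eigenspace_act.mp hx))
    (fun x hx => mem_inf_eigenspace_act.mpr (mem_inf_eigenspace_act.mp hx).Z_smul)
  have hwt := mem_inf_eigenspace_act.mp hvW
  have hv := IsMaximalVector.of_B1_smul hv0 hwt (hB1 v hwt) hZv
  obtain ⟨i, hi0, hi, hζ⟩ := hv.exists_eq_domZeta
  exact ⟨d, e, n, i, v, hi0, hi, hζ ▸ hv⟩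

theorem domZeta_injective (κd κ1 n : ℤ) : Function.Injective (domZeta κd κ1 n) := by
  intro i i' h
  have := qInt_injective (sub_left_injective h)
  omega

theorem IsMaximalVector.weight_unique [IsSimpleModule U V] {d e n i d' e' n' i' : ℤ} {v v' : V}
    (hv : IsMaximalVector V d e (qInt n) (domZeta d e n i) v)
    (hv' : IsMaximalVector V d' e' (qInt n') (domZeta d' e' n' i') v') :
    d = d' ∧ e = e' ∧ n = n' ∧ i = i' := by
  have hgen := IsSimpleModule.span_singleton_eq_top U hv.ne_zero
  have hgen' := IsSimpleModule.span_singleton_eq_top U hv'.ne_zero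
  have hwt := hv.isWeightVector
  have hwt' := hv'.isWeightVector
  obtain rfl : d = d' := le_antisymm (hv'.le_of_Dd_smul hgen' hv.ne_zero hwt.Dd_smul)
    (hv.le_of_Dd_smul hgen hv'.ne_zero hwt'.Dd_smul)
  obtain ⟨c, rfl⟩ := Submodule.mem_span_singleton.mp
    (hv.eigenspace_Dd_top hgen ▸ mem_eigenspace_act.mpr hwt'.Dd_smul)
  have heq {u : U} {a b : Cq} (ha : u • v = a • v) (hb : u • c • v = b • c • v) : a = b := by
    rw [smul_scalar_smul, ha, smul_comm] at hb
    exact smul_left_injective Cq hv'.ne_zero hb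
  obtain rfl := q_zpow_injective (heq hwt.D1_smul hwt'.D1_smul)
  obtain rfl := qInt_injective (heq hwt.B0_smul hwt'.B0_smul)
  exact ⟨rfl, rfl, rfl, domZeta_injective d e n (heq hv.Z_smul hv'.Z_smul)⟩

section Map

variable {V' : Type*} [AddCommGroup V'] [Module Cq V'] [Module U V'] [IsScalarTower Cq U V']
  {d e : ℤ} {β ζ : Cq} {v : V}

theorem IsMaximalVector.map (f : V →ₗ[U] V') (hv : IsMaximalVector V d e β ζ v)
    (hfv : f v ≠ 0) : IsMaximalVector V' d e β ζ (f v) := by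
  have hf {u : U} {c : Cq} (h : u • v = c • v) : u • f v = c • f v := by
    rw [← map_smul, h, LinearMap.map_smul_of_tower]
  obtain ⟨hDd, hD1, hB0, hZ⟩ := QSP.mem_weightSpace.mp hv.mem_weightSpace
  refine ⟨hfv, QSP.mem_weightSpace.mpr ⟨hf hDd, hf hD1, hf hB0, hf hZ⟩, ?_, ?_⟩
  · rw [← map_smul, hv.B1_smul, map_zero]
  · rw [← map_smul, hv.X_smul, map_zero]

theorem IsMaximalVector.of_map {f : V →ₗ[U] V'} (hf : Function.Injective f)
    (hv : IsMaximalVector V' d e β ζ (f v)) : IsMaximalVector V d e β ζ v := by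
  have heigen {u : U} {c : Cq} (h : u • f v = c • f v) : u • v = c • v :=
    hf (by rw [map_smul, h, LinearMap.map_smul_of_tower])
  obtain ⟨hDd, hD1, hB0, hZ⟩ := QSP.mem_weightSpace.mp hv.mem_weightSpace
  refine ⟨fun h => hv.ne_zero (by rw [h, map_zero]),
    QSP.mem_weightSpace.mpr ⟨heigen hDd, heigen hD1, heigen hB0, heigen hZ⟩, hf ?_, hf ?_⟩
  · rw [map_smul, hv.B1_smul, map_zero]
  · rw [map_smul, hv.X_smul, map_zero]

end Map

end

/-! ### Verma modules and their irreducible quotients -/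

section

variable (κd κ1 : ℤ) (β ζ : Cq)

/-- The universal maximal vector, which generates the Verma module. -/
def vermaGen : Verma κd κ1 β ζ := (vermaIdeal κd κ1 β ζ).mkQ 1

variable {κd κ1 β ζ}

theorem smul_vermaGen (u : U) : u • vermaGen κd κ1 β ζ = (vermaIdeal κd κ1 β ζ).mkQ u := by
  rw [vermaGen, ← map_smul, smul_eq_mul, mul_one]

theorem smul_vermaGen_eq_zero {u : U} (h : u ∈ vermaIdeal κd κ1 β ζ) :
    u • vermaGen κd κ1 β ζ = 0 :=
  (smul_vermaGen u).trans ((Submodule.Quotient.mk_eq_zero _).mpr h)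

theorem span_vermaGen : Submodule.span U {vermaGen κd κ1 β ζ} = ⊤ := by
  refine Submodule.eq_top_iff'.mpr fun x => ?_
  obtain ⟨u, rfl⟩ := (vermaIdeal κd κ1 β ζ).mkQ_surjective x
  exact Submodule.mem_span_singleton.mpr ⟨u, smul_vermaGen u⟩

theorem isMaximalVector_vermaGen (h : vermaGen κd κ1 β ζ ≠ 0) :
    IsMaximalVector (Verma κd κ1 β ζ) κd κ1 β ζ (vermaGen κd κ1 β ζ) := by
  have heigen {u : U} {c : Cq} (hu : u - algebraMap Cq U c ∈ vermaIdeal κd κ1 β ζ) :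
      u • vermaGen κd κ1 β ζ = c • vermaGen κd κ1 β ζ := by
    rw [← sub_eq_zero, ← smul_vermaGen_eq_zero hu, sub_smul]
    rw [smul_vermaGen (algebraMap Cq U c), Algebra.algebraMap_eq_smul_one,
      LinearMap.map_smul_of_tower, vermaGen]
  refine ⟨h, mem_weightSpace.mpr ⟨heigen ?_, heigen ?_, heigen ?_, heigen ?_⟩,
    smul_vermaGen_eq_zero ?_, smul_vermaGen_eq_zero ?_⟩ <;>
  exact Submodule.subset_span (by simp)

variable {V : Type*} [AddCommGroup V] [Module Cq V] [Module U V] [IsScalarTower Cq U V]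

theorem IsMaximalVector.vermaIdeal_le {v : V} (hv : IsMaximalVector V κd κ1 β ζ v) :
    vermaIdeal κd κ1 β ζ ≤ LinearMap.ker (LinearMap.toSpanSingleton U V v) := by
  obtain ⟨hDd, hD1, hB0, hZ⟩ := QSP.mem_weightSpace.mp hv.mem_weightSpace
  rw [vermaIdeal, Submodule.span_le]
  rintro _ (rfl | rfl | rfl | rfl | rfl | rfl) <;>
    simp only [SetLike.mem_coe, LinearMap.mem_ker, LinearMap.toSpanSingleton_apply, sub_smul,
      algebraMap_smul, sub_eq_zero]
  exacts [hv.B1_smul, hv.X_smul, hDd, hD1, hB0, hZ]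

theorem IsMaximalVector.exists_verma_hom {v : V} (hv : IsMaximalVector V κd κ1 β ζ v) :
    ∃ f : Verma κd κ1 β ζ →ₗ[U] V, f (vermaGen κd κ1 β ζ) = v := by
  refine ⟨(vermaIdeal κd κ1 β ζ).liftQ _ hv.vermaIdeal_le, ?_⟩
  rw [vermaGen, Submodule.mkQ_apply, Submodule.liftQ_apply, LinearMap.toSpanSingleton_apply,
    one_smul]

theorem IsMaximalVector.vermaGen_ne_zero {v : V} (hv : IsMaximalVector V κd κ1 β ζ v) :
    vermaGen κd κ1 β ζ ≠ 0 := by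
  obtain ⟨f, hf⟩ := hv.exists_verma_hom
  exact fun h => hv.ne_zero (by rw [← hf, h, map_zero])

theorem le_vermaRadical {N : Submodule U (Verma κd κ1 β ζ)} (hN : N ≠ ⊤) :
    N ≤ vermaRadical κd κ1 β ζ :=
  le_sSup hN

theorem isCoatom_vermaRadical {n : ℤ} (h : vermaGen κd κ1 (qInt n) ζ ≠ 0) :
    IsCoatom (vermaRadical κd κ1 (qInt n) ζ) :=
  ⟨(isMaximalVector_vermaGen h).sSup_setOf_ne_top_ne_top span_vermaGen, fun _ hN => by
    by_contra hne
    exact hN.not_ge (le_vermaRadical hne)⟩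

theorem isSimpleModule_L {n : ℤ} (h : vermaGen κd κ1 (qInt n) ζ ≠ 0) :
    IsSimpleModule U (L κd κ1 (qInt n) ζ) :=
  isSimpleModule_iff_isCoatom.mpr (isCoatom_vermaRadical h)

theorem isMaximalVector_L {n : ℤ} (h : vermaGen κd κ1 (qInt n) ζ ≠ 0) :
    IsMaximalVector (L κd κ1 (qInt n) ζ) κd κ1 (qInt n) ζ
      ((vermaRadical κd κ1 (qInt n) ζ).mkQ (vermaGen κd κ1 (qInt n) ζ)) := by
  refine (isMaximalVector_vermaGen h).map _ fun h0 => (isCoatom_vermaRadical h).1 ?_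
  rw [← top_le_iff, ← span_vermaGen, Submodule.span_singleton_le_iff_mem]
  exact (Submodule.Quotient.mk_eq_zero _).mp h0

theorem IsMaximalVector.nonempty_equiv_L [IsSimpleModule U V] {n : ℤ} {v : V}
    (hv : IsMaximalVector V κd κ1 (qInt n) ζ v) : Nonempty (V ≃ₗ[U] L κd κ1 (qInt n) ζ) := by
  obtain ⟨f, hf⟩ := hv.exists_verma_hom
  have hsurj : Function.Surjective f := LinearMap.surjective_of_ne_zero fun h =>
    hv.ne_zero (by rw [← hf, h, LinearMap.zero_apply])
  have hker : IsCoatom (LinearMap.ker f) := isSimpleModule_iff_isCoatom.mp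
    (IsSimpleModule.congr (f.quotKerEquivOfSurjective hsurj))
  have heq : LinearMap.ker f = vermaRadical κd κ1 (qInt n) ζ :=
    ((hker.le_iff.mp (le_vermaRadical hker.1)).resolve_left
      (isCoatom_vermaRadical hv.vermaGen_ne_zero).1).symm
  exact ⟨(f.quotKerEquivOfSurjective hsurj).symm.trans (Submodule.quotEquivOfEq _ _ heq)⟩

theorem IsMaximalVector.finite_L [Module.Finite Cq V] {v : V}
    (hv : IsMaximalVector V κd κ1 β ζ v) : Module.Finite Cq (L κd κ1 β ζ) := by
  obtain ⟨f, hf⟩ := hv.exists_verma_hom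
  have hker : LinearMap.ker f ≤ vermaRadical κd κ1 β ζ := le_vermaRadical fun h => hv.ne_zero <| by
    rw [← hf, LinearMap.ker_eq_top.mp h, LinearMap.zero_apply]
  have hinj : Function.Injective ((LinearMap.ker f).liftQ f le_rfl) :=
    LinearMap.ker_eq_bot.mp (Submodule.ker_liftQ_eq_bot _ _ _ le_rfl)
  have : Module.Finite Cq (Verma κd κ1 β ζ ⧸ LinearMap.ker f) :=
    Module.Finite.of_injective (((LinearMap.ker f).liftQ f le_rfl).restrictScalars Cq) hinj
  exact Module.Finite.of_surjective ((Submodule.factor hker).restrictScalars Cq)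
    (Submodule.factor_surjective hker)

end

/-! ### Finite-dimensional modules with a prescribed maximal vector -/

theorem qInt_serre (k : ℤ) (ε : ℤˣ) :
    qInt (k + ε) ^ 2 - qInt 2 * qInt (k + ε) * qInt k + qInt k ^ 2 = 1 := by
  have h0 := q_ne_zero
  have h1 := q_sq_sub_one_ne_zero
  rw [qInt_two]
  rcases Int.units_eq_one_or ε with rfl | rfl <;>
    simp only [qInt, Units.val_one, Units.val_neg, neg_add, zpow_neg, zpow_add₀ h0, zpow_one] <;>
    field_simp <;> ring

theorem qInt_two_mul_qInt (k : ℤ) (ε : ℤˣ) :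
    qInt 2 * qInt (k + ε) = qInt k + qInt (k + ε + ε) := by
  have h0 := q_ne_zero
  have h1 := q_sq_sub_one_ne_zero
  rw [qInt_two]
  rcases Int.units_eq_one_or ε with rfl | rfl <;>
    simp only [qInt, Units.val_one, Units.val_neg, neg_add, zpow_neg, zpow_add₀ h0, zpow_one] <;>
    field_simp <;> ring

theorem qInt_two_mul_qInt_sub (k : ℤ) (ε : ℤˣ) :
    qInt 2 * qInt (k + ε) - 2 * qInt k = (ε : ℤ) * qCosh (k + ε) := by
  have h0 := q_ne_zero
  have h1 := q_sq_sub_one_ne_zero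
  rw [qInt_two]
  rcases Int.units_eq_one_or ε with rfl | rfl <;>
    simp only [qInt, qCosh, Units.val_one, Units.val_neg, neg_add, zpow_neg, zpow_add₀ h0, zpow_one,
      Int.cast_one, Int.cast_neg] <;>
    field_simp <;> ring

/-- The vector space underlying the explicit modules: its basis vectors are the points of the
lattice `ℤ × ℤ`. -/
abbrev LatticeSpace : Type := (ℤ × ℤ) →₀ Cq

/-- The basis vector at the lattice point `(a, b)`. -/
def latticeVec (a b : ℤ) : LatticeSpace := Finsupp.single (a, b) 1

/-- The level of the lattice point `(a, b)`: at a point of level `c` the element `B0` acts by the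
quantum integer `[c]`. -/
def level (n a b : ℤ) : ℤ := n + a - b

/-- The diagonal operator with eigenvalue `c a b` at the lattice point `(a, b)`. -/
def diagOp (c : ℤ → ℤ → Cq) : Module.End Cq LatticeSpace :=
  Finsupp.linearCombination Cq fun p => c p.1 p.2 • latticeVec p.1 p.2

/-- The operator that moves each of the two coordinates by `ε`. The normalization by `qCosh` of the
level makes it satisfy the Serre relations for all coefficients `φ` and `ψ`, each depending on the
moving coordinate alone. -/
def stepOp (n : ℤ) (ε : ℤˣ) (φ ψ : ℤ → Cq) : Module.End Cq LatticeSpace :=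
  Finsupp.linearCombination Cq fun p => (qCosh (level n p.1 p.2))⁻¹ •
    (φ p.1 • latticeVec (p.1 + ε) p.2 + ψ p.2 • latticeVec p.1 (p.2 + ε))

section Operators

variable {n : ℤ}

theorem level_add_fst (a b m : ℤ) : level n (a + m) b = level n a b + m := by
  unfold level; ring

theorem level_add_snd (a b m : ℤ) : level n a (b + m) = level n a b - m := by
  unfold level; ring

theorem diagOp_latticeVec (c : ℤ → ℤ → Cq) (a b : ℤ) :
    diagOp c (latticeVec a b) = c a b • latticeVec a b := by
  simp only [diagOp, latticeVec, Finsupp.linearCombination_single, one_smul]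

theorem stepOp_latticeVec (ε : ℤˣ) (φ ψ : ℤ → Cq) (a b : ℤ) :
    stepOp n ε φ ψ (latticeVec a b) = (qCosh (level n a b))⁻¹ •
      (φ a • latticeVec (a + ε) b + ψ b • latticeVec a (b + ε)) := by
  simp only [stepOp, latticeVec, Finsupp.linearCombination_single, one_smul]

theorem latticeSpace_hom_ext {f g : Module.End Cq LatticeSpace}
    (h : ∀ a b, f (latticeVec a b) = g (latticeVec a b)) : f = g :=
  Finsupp.lhom_ext' fun p => LinearMap.ext_ring (h p.1 p.2)

theorem commute_diagOp (f g : ℤ → ℤ → Cq) : Commute (diagOp f) (diagOp g) :=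
  latticeSpace_hom_ext fun a b => by
    simp only [Module.End.mul_apply, diagOp_latticeVec, map_smul, smul_smul, mul_comm]

theorem diagOp_zpow_mul_diagOp_zpow_neg (m : ℤ → ℤ → ℤ) :
    diagOp (fun a b => q ^ m a b) * diagOp (fun a b => q ^ (-m a b)) = 1 :=
  latticeSpace_hom_ext fun a b => by
    rw [Module.End.mul_apply, diagOp_latticeVec, map_smul, diagOp_latticeVec, smul_smul,
      ← zpow_add₀ q_ne_zero, neg_add_cancel, zpow_zero, one_smul, Module.End.one_apply]

theorem diagOp_mul_stepOp {ε : ℤˣ} {f : ℤ → ℤ → Cq} {c : Cq} (φ ψ : ℤ → Cq)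
    (hfst : ∀ a b, f (a + ε) b = c * f a b) (hsnd : ∀ a b, f a (b + ε) = c * f a b) :
    diagOp f * stepOp n ε φ ψ = c • (stepOp n ε φ ψ * diagOp f) :=
  latticeSpace_hom_ext fun a b => by
    simp only [Module.End.mul_apply, diagOp_latticeVec, stepOp_latticeVec, map_add, map_smul, hfst,
      hsnd, LinearMap.smul_apply]
    module

theorem serre_diagOp_stepOp (ε : ℤˣ) (φ ψ : ℤ → Cq) :
    diagOp (fun a b => qInt (level n a b)) ^ 2 * stepOp n ε φ ψ -
      qInt 2 • (diagOp (fun a b => qInt (level n a b)) * stepOp n ε φ ψ *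
        diagOp fun a b => qInt (level n a b)) +
      stepOp n ε φ ψ * diagOp (fun a b => qInt (level n a b)) ^ 2 = stepOp n ε φ ψ := by
  refine latticeSpace_hom_ext fun a b => ?_
  have hfst := qInt_serre (level n a b) ε
  have hsnd := qInt_serre (level n a b) (-ε)
  rw [Units.val_neg, ← sub_eq_add_neg] at hsnd
  simp only [pow_two, Module.End.mul_apply, LinearMap.add_apply, LinearMap.sub_apply,
    LinearMap.smul_apply, stepOp_latticeVec, diagOp_latticeVec, map_add, map_smul, smul_add,
    level_add_fst, level_add_snd]
  match_scalars
  · linear_combination (qCosh (level n a b))⁻¹ * φ a * hfst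
  · linear_combination (qCosh (level n a b))⁻¹ * ψ b * hsnd

theorem serre_stepOp_diagOp (ε : ℤˣ) (φ ψ : ℤ → Cq) :
    stepOp n ε φ ψ ^ 2 * diagOp (fun a b => qInt (level n a b)) -
      qInt 2 • (stepOp n ε φ ψ * diagOp (fun a b => qInt (level n a b)) * stepOp n ε φ ψ) +
      diagOp (fun a b => qInt (level n a b)) * stepOp n ε φ ψ ^ 2 = 0 := by
  refine latticeSpace_hom_ext fun a b => ?_
  simp only [pow_two, Module.End.mul_apply, LinearMap.add_apply, LinearMap.sub_apply,
    LinearMap.smul_apply, stepOp_latticeVec, diagOp_latticeVec, map_add, map_smul, smul_add,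
    level_add_fst, level_add_snd, LinearMap.zero_apply, add_sub_cancel_right]
  generalize level n a b = c
  have hfst := qInt_two_mul_qInt c ε
  have hsnd := qInt_two_mul_qInt c (-ε)
  have hfst' := qInt_two_mul_qInt_sub c ε
  have hsnd' := qInt_two_mul_qInt_sub c (-ε)
  simp only [Units.val_neg, ← sub_eq_add_neg, Int.cast_neg] at hsnd hsnd'
  have hC := inv_mul_cancel₀ (qCosh_ne_zero (c + ε))
  have hC' := inv_mul_cancel₀ (qCosh_ne_zero (c - ε))
  match_scalars
  · linear_combination -(qCosh c)⁻¹ * (qCosh (c + ε))⁻¹ * φ a * φ (a + ε) * hfst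
  · linear_combination -(qCosh c)⁻¹ * φ a * ψ b * ((qCosh (c + ε))⁻¹ * hfst' +
      (qCosh (c - ε))⁻¹ * hsnd' + (ε : ℤ) * hC - (ε : ℤ) * hC')
  · linear_combination -(qCosh c)⁻¹ * (qCosh (c - ε))⁻¹ * ψ b * ψ (b + ε) * hsnd

theorem stepOp_commutator (φ ψ φ' ψ' : ℤ → Cq) :
    stepOp n (-1) φ' ψ' * stepOp n 1 φ ψ - stepOp n 1 φ ψ * stepOp n (-1) φ' ψ' =
      diagOp fun a b => (qCosh (level n a b))⁻¹ *
        ((qCosh (level n a b + 1))⁻¹ * (φ a * φ' (a + 1) - ψ' b * ψ (b - 1)) +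
          (qCosh (level n a b - 1))⁻¹ * (ψ b * ψ' (b + 1) - φ' a * φ (a - 1))) := by
  refine latticeSpace_hom_ext fun a b => ?_
  simp only [Module.End.mul_apply, LinearMap.sub_apply, stepOp_latticeVec, diagOp_latticeVec,
    map_add, map_smul, smul_add, level_add_fst, level_add_snd, Units.val_one, Units.val_neg,
    sub_eq_add_neg, neg_neg, add_neg_cancel_right, neg_add_cancel_right]
  module

/-- The operator by which `Bm1` acts; it leads nowhere out of the rectangle with corners `(0, 0)`
and `(r, s)`. -/
def lowerOp (n r s : ℤ) : Module.End Cq LatticeSpace :=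
  stepOp n 1 (fun a => qInt (r - a)) fun b => qInt (s - b)

/-- The operator by which `B1` acts; it leads nowhere out of the quadrant with corner `(0, 0)`. -/
def raiseOp (n r s : ℤ) : Module.End Cq LatticeSpace :=
  stepOp n (-1) (fun a => qInt a * qCosh (n + a - s - 1) * qCosh (n + a))
    fun b => qInt b * qCosh (n - b + r + 1) * qCosh (n - b)

theorem qInt_qCosh_commutator (n a b r s : ℤ) :
    qCosh (level n a b - 1) *
        (qInt (r - a) * (qInt (a + 1) * qCosh (n + (a + 1) - s - 1) * qCosh (n + (a + 1))) -
          qInt b * qCosh (n - b + r + 1) * qCosh (n - b) * qInt (s - (b - 1))) +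
      qCosh (level n a b + 1) *
        (qInt (s - b) * (qInt (b + 1) * qCosh (n - (b + 1) + r + 1) * qCosh (n - (b + 1))) -
          qInt a * qCosh (n + a - s - 1) * qCosh (n + a) * qInt (r - (a - 1))) =
      qCosh (level n a b) * qCosh (level n a b + 1) * qCosh (level n a b - 1) *
        qInt (r + s - 2 * (a + b)) := by
  have h0 := q_ne_zero
  have h1 := q_sq_sub_one_ne_zero
  have hn := zpow_ne_zero n h0
  have ha := zpow_ne_zero a h0
  have hb := zpow_ne_zero b h0
  have hr := zpow_ne_zero r h0
  have hs := zpow_ne_zero s h0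
  simp only [qInt, qCosh, level, neg_add, two_mul, zpow_neg, zpow_sub₀ h0, zpow_add₀ h0, zpow_one]
  generalize q ^ n = x at *
  generalize q ^ a = α at *
  generalize q ^ b = δ at *
  generalize q ^ r = ρ at *
  generalize q ^ s = σ at *
  field_simp
  ring

theorem raiseOp_commutator (n r s : ℤ) :
    raiseOp n r s * lowerOp n r s - lowerOp n r s * raiseOp n r s =
      diagOp fun a b => qInt (r + s - 2 * (a + b)) := by
  rw [raiseOp, lowerOp, stepOp_commutator]
  congr! 3 with a b
  have hC := qCosh_ne_zero (level n a b)
  have hC₁ := qCosh_ne_zero (level n a b + 1)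
  have hC₂ := qCosh_ne_zero (level n a b - 1)
  field_simp
  linear_combination qInt_qCosh_commutator n a b r s

/-- The action of the generators on the module of highest weight
`(d, d - r - s, [n], [n + r - s] - q ^ (-(r + s)) [n])`. -/
def genOp (d n r s : ℤ) : Gen → Module.End Cq LatticeSpace
  | .B0 => diagOp fun a b => qInt (level n a b)
  | .B1 => raiseOp n r s
  | .Bm1 => lowerOp n r s
  | .Dd => diagOp fun a b => q ^ (d - (a + b))
  | .DdInv => diagOp fun a b => q ^ (-(d - (a + b)))
  | .D1 => diagOp fun a b => q ^ (d - r - s + (a + b))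
  | .D1Inv => diagOp fun a b => q ^ (-(d - r - s + (a + b)))

theorem genOp_B1_commutator (d n r s : ℤ) :
    genOp d n r s .B1 * genOp d n r s .Bm1 - genOp d n r s .Bm1 * genOp d n r s .B1 =
      (q - q⁻¹)⁻¹ • (genOp d n r s .Dd * genOp d n r s .D1Inv -
        genOp d n r s .D1 * genOp d n r s .DdInv) := by
  simp only [genOp, raiseOp_commutator]
  refine latticeSpace_hom_ext fun a b => ?_
  have hpos : -(d - r - s + (a + b)) + (d - (a + b)) = r + s - 2 * (a + b) := by ring
  have hneg : -(d - (a + b)) + (d - r - s + (a + b)) = -(r + s - 2 * (a + b)) := by ring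
  simp only [LinearMap.smul_apply, LinearMap.sub_apply, Module.End.mul_apply,
    diagOp_latticeVec, map_smul, smul_smul, ← zpow_add₀ q_ne_zero, ← sub_smul, hpos, hneg]
  rw [qInt, div_eq_inv_mul]

theorem genOp_rel {d n r s : ℤ} {x y : Free} (h : Rel x y) :
    FreeAlgebra.lift Cq (genOp d n r s) x = FreeAlgebra.lift Cq (genOp d n r s) y := by
  have h0 := q_ne_zero
  cases h <;> simp only [gen, map_mul, map_sub, map_add, map_smul, map_pow, map_one, map_zero,
    FreeAlgebra.lift_ι_apply]
  case B1_Bm1 => exact genOp_B1_commutator d n r s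
  all_goals simp only [genOp]
  case Dd_mul_inv => exact diagOp_zpow_mul_diagOp_zpow_neg _
  case Dd_inv_mul => exact (commute_diagOp _ _).eq.trans (diagOp_zpow_mul_diagOp_zpow_neg _)
  case D1_mul_inv => exact diagOp_zpow_mul_diagOp_zpow_neg _
  case D1_inv_mul => exact (commute_diagOp _ _).eq.trans (diagOp_zpow_mul_diagOp_zpow_neg _)
  case Dd_D1 => exact commute_diagOp _ _
  case B0_Dd => exact commute_diagOp _ _
  case B0_D1 => exact commute_diagOp _ _
  case Dd_B1 =>
    refine diagOp_mul_stepOp _ _ (fun a b => ?_) (fun a b => ?_) <;>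
      rw [← zpow_one_add₀ h0, Units.val_neg, Units.val_one] <;> ring_nf
  case Dd_Bm1 =>
    refine diagOp_mul_stepOp _ _ (fun a b => ?_) (fun a b => ?_) <;>
      rw [← zpow_neg_one, ← zpow_add₀ h0, Units.val_one] <;> ring_nf
  case D1_B1 =>
    refine diagOp_mul_stepOp _ _ (fun a b => ?_) (fun a b => ?_) <;>
      rw [← zpow_neg_one, ← zpow_add₀ h0, Units.val_neg, Units.val_one] <;> ring_nf
  case D1_Bm1 =>
    refine diagOp_mul_stepOp _ _ (fun a b => ?_) (fun a b => ?_) <;>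
      rw [← zpow_one_add₀ h0, Units.val_one] <;> ring_nf
  case serre_B0_B1 => exact serre_diagOp_stepOp _ _ _
  case serre_B0_Bm1 => exact serre_diagOp_stepOp _ _ _
  case serre_B1_B0 => exact serre_stepOp_diagOp _ _ _
  case serre_Bm1_B0 => exact serre_stepOp_diagOp _ _ _

end Operators

section LatticeRepresentation

/-- The representation of the algebra on the lattice space. -/
def latticeRep (d n r s : ℤ) : U →ₐ[Cq] Module.End Cq LatticeSpace :=
  RingQuot.liftAlgHom Cq ⟨FreeAlgebra.lift Cq (genOp d n r s), fun _ _ h => genOp_rel h⟩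

/-- The lattice space as a module over the algebra; the parameters select the representation. -/
def LatticeModule (_d _n _r _s : ℤ) : Type := LatticeSpace

variable {d n r s : ℤ}

instance : AddCommGroup (LatticeModule d n r s) := inferInstanceAs (AddCommGroup LatticeSpace)

instance : Module Cq (LatticeModule d n r s) := inferInstanceAs (Module Cq LatticeSpace)

instance : Module (Module.End Cq LatticeSpace) (LatticeModule d n r s) :=
  inferInstanceAs (Module (Module.End Cq LatticeSpace) LatticeSpace)

instance : Module U (LatticeModule d n r s) := Module.compHom _ (latticeRep d n r s).toRingHom

theorem lattice_smul (u : U) (x : LatticeModule d n r s) : u • x = latticeRep d n r s u x := rfl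

instance : IsScalarTower Cq U (LatticeModule d n r s) where
  smul_assoc c u x := by rw [lattice_smul, map_smul]; rfl

variable (d n r s)

/-- The basis vector at `(a, b)`, as an element of the module. -/
def LatticeModule.vec (a b : ℤ) : LatticeModule d n r s := latticeVec a b

theorem cls_smul_vec (g : Gen) (a b : ℤ) :
    cls g • LatticeModule.vec d n r s a b = (genOp d n r s g (latticeVec a b) : LatticeSpace) := by
  rw [lattice_smul, latticeRep, cls, RingQuot.liftAlgHom_mkAlgHom_apply, gen,
    FreeAlgebra.lift_ι_apply]
  rfl

theorem Bm1_smul_vec (a b : ℤ) :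
    Bm1 • LatticeModule.vec d n r s a b = (qCosh (level n a b))⁻¹ •
      (qInt (r - a) • LatticeModule.vec d n r s (a + 1) b +
        qInt (s - b) • LatticeModule.vec d n r s a (b + 1)) :=
  (cls_smul_vec d n r s .Bm1 a b).trans (by rw [genOp, lowerOp, stepOp_latticeVec]; rfl)

theorem B1_smul_vec (a b : ℤ) :
    B1 • LatticeModule.vec d n r s a b = (qCosh (level n a b))⁻¹ •
      ((qInt a * qCosh (n + a - s - 1) * qCosh (n + a)) • LatticeModule.vec d n r s (a - 1) b +
        (qInt b * qCosh (n - b + r + 1) * qCosh (n - b)) • LatticeModule.vec d n r s a (b - 1)) :=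
  (cls_smul_vec d n r s .B1 a b).trans (by rw [genOp, raiseOp, stepOp_latticeVec]; rfl)

theorem isWeightVector_vec (a b : ℤ) :
    IsWeightVector (d - (a + b)) (d - r - s + (a + b)) (level n a b)
      (LatticeModule.vec d n r s a b) where
  Dd_smul := (cls_smul_vec d n r s .Dd a b).trans (by rw [genOp, diagOp_latticeVec]; rfl)
  D1_smul := (cls_smul_vec d n r s .D1 a b).trans (by rw [genOp, diagOp_latticeVec]; rfl)
  B0_smul := (cls_smul_vec d n r s .B0 a b).trans (by rw [genOp, diagOp_latticeVec]; rfl)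

theorem lowering_one_smul_vec (a b : ℤ) :
    lowering 1 (level n a b) • LatticeModule.vec d n r s a b =
      qInt (r - a) • LatticeModule.vec d n r s (a + 1) b := by
  have hB0 (a b : ℤ) := (isWeightVector_vec d n r s a b).B0_smul
  have hY := (isWeightVector_vec d n r s a b).B0_smul_Bm1
  rw [lowering, add_smul, smul_assoc, eq_sub_of_add_eq hY.symm, Bm1_smul_vec, smul_scalar_smul,
    smul_add, smul_scalar_smul, smul_scalar_smul, hB0, hB0, level_add_fst, level_add_snd]
  have hC := inv_mul_cancel₀ (qCosh_ne_zero (level n a b))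
  generalize level n a b = c at *
  have hfst := qInt_succ c
  have hsnd := qInt_succ (-c)
  rw [neg_add_eq_sub, ← neg_sub c, qInt_neg, qInt_neg] at hsnd
  simp only [Units.val_one, Int.cast_one, one_mul]
  match_scalars
  · rw [hfst]
    rw [qCosh] at hC ⊢
    linear_combination qInt (r - a) * hC
  · linear_combination -(qCosh c)⁻¹ * qInt (s - b) * hsnd

theorem B1_smul_vec_zero : B1 • LatticeModule.vec d n r s 0 0 = 0 := by
  simp only [B1_smul_vec, qInt_zero, zero_mul, zero_smul, add_zero, smul_zero]

theorem qInt_mul_qCosh_sub (n r s : ℤ) :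
    qInt r * qCosh (n - s) - q ^ (-n) * qInt (r + s) =
      qInt (n + (r + s) - 2 * s) - q ^ (-(r + s)) * qInt n := by
  have h0 := q_ne_zero
  have h1 := q_sq_sub_one_ne_zero
  simp only [qInt, qCosh, neg_add, two_mul, zpow_neg, zpow_sub₀ h0, zpow_add₀ h0]
  field_simp
  ring

theorem Z_smul_vec_zero :
    Z • LatticeModule.vec d n r s 0 0 =
      domZeta d (d - r - s) n s • LatticeModule.vec d n r s 0 0 := by
  have hw := isWeightVector_vec d n r s 0 0
  have hlow := lowering_one_smul_vec d n r s 0 0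
  have hB1 := B1_smul_lowering_smul 1 (level n 0 0) (LatticeModule.vec d n r s 0 0)
  rw [hlow, smul_scalar_smul, B1_smul_vec, B1_smul_vec_zero, H_smul hw.Dd_smul hw.D1_smul] at hB1
  have hC := inv_mul_cancel₀ (qCosh_ne_zero (n + 1))
  have hd : d - (d - r - s) = r + s := by ring
  simp only [level, zero_add, add_zero, sub_zero, smul_zero, qInt_zero, qInt_one, zero_mul,
    zero_smul, one_mul, Units.val_one, Int.cast_one, sub_self, hd,
    show n + 1 - s - 1 = n - s by ring] at hB1
  rw [← sub_eq_iff_eq_add.mpr hB1, domZeta, hd, ← qInt_mul_qCosh_sub]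
  match_scalars
  linear_combination qInt r * qCosh (n - s) * hC

theorem isMaximalVector_vec_zero :
    IsMaximalVector (LatticeModule d n r s) d (d - r - s) (qInt n) (domZeta d (d - r - s) n s)
      (LatticeModule.vec d n r s 0 0) := by
  refine .of_B1_smul (Finsupp.single_ne_zero.mpr one_ne_zero) ?_ (B1_smul_vec_zero d n r s)
    (Z_smul_vec_zero d n r s)
  simpa [level] using isWeightVector_vec d n r s 0 0

/-- The span of the basis vectors in the rectangle with corners `(0, 0)` and `(r, s)`, as a vector
space. -/
def LatticeModule.rectangleSpan : Submodule Cq (LatticeModule d n r s) :=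
  Submodule.span Cq
    ((fun p : ℤ × ℤ => LatticeModule.vec d n r s p.1 p.2) '' (Set.Icc 0 r ×ˢ Set.Icc 0 s))

variable {d n r s}

theorem smul_vec_mem_rectangleSpan {a b : ℤ} {c : Cq}
    (h : c ≠ 0 → 0 ≤ a ∧ a ≤ r ∧ 0 ≤ b ∧ b ≤ s) :
    c • LatticeModule.vec d n r s a b ∈ LatticeModule.rectangleSpan d n r s := by
  by_cases hc : c = 0
  · rw [hc, zero_smul]
    exact Submodule.zero_mem _
  · obtain ⟨ha, har, hb, hbs⟩ := h hc
    exact Submodule.smul_mem _ _ (Submodule.subset_span ⟨(a, b), ⟨⟨ha, har⟩, ⟨hb, hbs⟩⟩, rfl⟩)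

theorem cls_smul_vec_mem_rectangleSpan {a b : ℤ} (hab : 0 ≤ a ∧ a ≤ r ∧ 0 ≤ b ∧ b ≤ s) (g : Gen) :
    cls g • LatticeModule.vec d n r s a b ∈ LatticeModule.rectangleSpan d n r s := by
  have hdiag {f : ℤ → ℤ → Cq} (hf : genOp d n r s g = diagOp f) :
      cls g • LatticeModule.vec d n r s a b ∈ LatticeModule.rectangleSpan d n r s := by
    rw [cls_smul_vec, hf, diagOp_latticeVec]
    exact smul_vec_mem_rectangleSpan fun _ => hab
  cases g with
  | B0 | Dd | DdInv | D1 | D1Inv => exact hdiag (by rw [genOp])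
  | B1 =>
    change B1 • _ ∈ _
    rw [B1_smul_vec]
    refine Submodule.smul_mem _ _ (Submodule.add_mem _
      (smul_vec_mem_rectangleSpan fun hc => ?_) (smul_vec_mem_rectangleSpan fun hc => ?_))
    · have : a ≠ 0 := fun h => hc (by simp only [h, qInt_zero, zero_mul])
      lia
    · have : b ≠ 0 := fun h => hc (by simp only [h, qInt_zero, zero_mul])
      lia
  | Bm1 =>
    change Bm1 • _ ∈ _
    rw [Bm1_smul_vec]
    refine Submodule.smul_mem _ _ (Submodule.add_mem _
      (smul_vec_mem_rectangleSpan fun hc => ?_) (smul_vec_mem_rectangleSpan fun hc => ?_))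
    · have : a ≠ r := fun h => hc (by rw [h, sub_self, qInt_zero])
      lia
    · have : b ≠ s := fun h => hc (by rw [h, sub_self, qInt_zero])
      lia

variable (d n r s) in
/-- The span of the basis vectors in the rectangle with corners `(0, 0)` and `(r, s)`, as a module
over the algebra. -/
def LatticeModule.rectangle : Submodule U (LatticeModule d n r s) where
  __ := LatticeModule.rectangleSpan d n r s
  smul_mem' := by
    refine fun u x => smul_mem_of_forall_cls (fun g => smul_mem_span ?_) u x
    rintro _ ⟨⟨a, b⟩, ⟨⟨ha, har⟩, ⟨hb, hbs⟩⟩, rfl⟩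
    exact cls_smul_vec_mem_rectangleSpan ⟨ha, har, hb, hbs⟩ g

instance : Module.Finite Cq (LatticeModule.rectangle d n r s) :=
  FiniteDimensional.span_of_finite Cq
    (((Set.finite_Icc 0 r).prod (Set.finite_Icc 0 s)).image _)

theorem vec_zero_mem_rectangle (hr : 0 ≤ r) (hs : 0 ≤ s) :
    LatticeModule.vec d n r s 0 0 ∈ LatticeModule.rectangle d n r s :=
  Submodule.subset_span ⟨(0, 0), ⟨⟨le_rfl, hr⟩, ⟨le_rfl, hs⟩⟩, rfl⟩

theorem isMaximalVector_rectangle (hr : 0 ≤ r) (hs : 0 ≤ s) :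
    IsMaximalVector (LatticeModule.rectangle d n r s) d (d - r - s) (qInt n)
      (domZeta d (d - r - s) n s) ⟨LatticeModule.vec d n r s 0 0, vec_zero_mem_rectangle hr hs⟩ :=
  .of_map (Submodule.subtype_injective _) (isMaximalVector_vec_zero d n r s)

end LatticeRepresentation

/-! ### Classification of the irreducible rational modules -/

section Dominant

variable {κd κ1 n i : ℤ}

theorem vermaGen_domZeta_ne_zero (h0 : 0 ≤ i) (hi : i ≤ κd - κ1) :
    vermaGen κd κ1 (qInt n) (domZeta κd κ1 n i) ≠ 0 := by
  obtain ⟨r, rfl⟩ : ∃ r, κ1 = κd - r - i := ⟨κd - κ1 - i, by ring⟩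
  exact (isMaximalVector_rectangle (by lia) h0).vermaGen_ne_zero

theorem finite_L_domZeta (h0 : 0 ≤ i) (hi : i ≤ κd - κ1) :
    Module.Finite Cq (L κd κ1 (qInt n) (domZeta κd κ1 n i)) := by
  obtain ⟨r, rfl⟩ : ∃ r, κ1 = κd - r - i := ⟨κd - κ1 - i, by ring⟩
  exact (isMaximalVector_rectangle (by lia) h0).finite_L

theorem isSimpleModule_L_domZeta (h0 : 0 ≤ i) (hi : i ≤ κd - κ1) :
    IsSimpleModule U (L κd κ1 (qInt n) (domZeta κd κ1 n i)) :=
  isSimpleModule_L (vermaGen_domZeta_ne_zero h0 hi)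

theorem isRational_L_domZeta (h0 : 0 ≤ i) (hi : i ≤ κd - κ1) :
    IsRational (L κd κ1 (qInt n) (domZeta κd κ1 n i)) := by
  have := finite_L_domZeta (n := n) h0 hi
  have := isSimpleModule_L_domZeta (n := n) h0 hi
  have hv := isMaximalVector_L (vermaGen_domZeta_ne_zero (n := n) h0 hi)
  exact hv.isRational (IsSimpleModule.span_singleton_eq_top U hv.ne_zero)

end Dominant

/-- The module `V` has a maximal vector of the dominant weight with parameters `κd, κ1, n, i`, that
is, of weight `(q ^ κd, q ^ κ1, [n], [n + κ - 2 i] - q ^ (-κ) [n])` with `0 ≤ i ≤ κ = κd - κ1`. -/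
structure HasHighestWeight (V : Type*) [AddCommGroup V] [Module Cq V] [Module U V]
    [IsScalarTower Cq U V] (κd κ1 n i : ℤ) : Prop where
  nonneg : 0 ≤ i
  le_sub : i ≤ κd - κ1
  exists_isMaximalVector : ∃ v : V, IsMaximalVector V κd κ1 (qInt n) (domZeta κd κ1 n i) v

section HighestWeight

variable {κd κ1 n i : ℤ}

theorem hasHighestWeight_L (h0 : 0 ≤ i) (hi : i ≤ κd - κ1) :
    HasHighestWeight (L κd κ1 (qInt n) (domZeta κd κ1 n i)) κd κ1 n i :=
  ⟨h0, hi, _, isMaximalVector_L (vermaGen_domZeta_ne_zero h0 hi)⟩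

variable {V : Type*} [AddCommGroup V] [Module Cq V] [Module U V] [IsScalarTower Cq U V]

theorem HasHighestWeight.of_equiv {V' : Type*} [AddCommGroup V'] [Module Cq V'] [Module U V']
    [IsScalarTower Cq U V'] (h : HasHighestWeight V κd κ1 n i) (f : V ≃ₗ[U] V') :
    HasHighestWeight V' κd κ1 n i := by
  obtain ⟨h0, hi, v, hv⟩ := h
  exact ⟨h0, hi, f v, hv.map f.toLinearMap (f.map_ne_zero_iff.mpr hv.ne_zero)⟩

variable [IsSimpleModule U V]

theorem HasHighestWeight.nonempty_equiv_L (h : HasHighestWeight V κd κ1 n i) :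
    Nonempty (V ≃ₗ[U] L κd κ1 (qInt n) (domZeta κd κ1 n i)) :=
  h.exists_isMaximalVector.elim fun _ hv => hv.nonempty_equiv_L

theorem HasHighestWeight.unique {κd' κ1' n' i' : ℤ} (h : HasHighestWeight V κd κ1 n i)
    (h' : HasHighestWeight V κd' κ1' n' i') : κd = κd' ∧ κ1 = κ1' ∧ n = n' ∧ i = i' := by
  obtain ⟨-, -, v, hv⟩ := h
  obtain ⟨-, -, v', hv'⟩ := h'
  exact hv.weight_unique hv'

theorem IsRational.exists_hasHighestWeight (hV : IsRational V) :
    ∃ κd κ1 n i : ℤ, HasHighestWeight V κd κ1 n i := by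
  have := IsSimpleModule.nontrivial U V
  obtain ⟨κd, κ1, n, i, v, h0, hi, hv⟩ := hV.exists_isMaximalVector
  exact ⟨κd, κ1, n, i, h0, hi, v, hv⟩

theorem IsRational.isSumOfWeightLines (hV : IsRational V) : IsSumOfWeightLines V := by
  obtain ⟨_, _, _, _, -, -, v, hv⟩ := hV.exists_hasHighestWeight
  exact hv.isSumOfWeightLines (IsSimpleModule.span_singleton_eq_top U hv.ne_zero)

end HighestWeight

/-! ### The bijection with pairs of half-integral partitions -/

theorem label_injective {κd κ1 n i κd' κ1' n' i' : ℤ}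
    (h : label κd κ1 n i = label κd' κ1' n' i') : κd = κd' ∧ κ1 = κ1' ∧ n = n' ∧ i = i' := by
  simp only [label, Prod.mk.injEq] at h
  obtain ⟨⟨hadd, hadd_i⟩, hsub, hsub_κ⟩ := h
  refine ⟨?_, ?_, ?_, ?_⟩ <;> refine Int.cast_injective (α := ℚ) ?_ <;> linarith

theorem label_mem_PHalfPairs {κd κ1 n i : ℤ} (h0 : 0 ≤ i) (hi : i ≤ κd - κ1) :
    label κd κ1 n i ∈ PHalfPairs := by
  obtain ⟨j, rfl⟩ := Int.eq_ofNat_of_zero_le h0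
  obtain ⟨k, hk⟩ := Int.eq_ofNat_of_zero_le (sub_nonneg.mpr hi)
  have hk' : (κd : ℚ) - κ1 - j = k := by exact_mod_cast hk
  refine ⟨⟨⟨j, ?_⟩, ⟨κd + n, ?_⟩, ⟨κd + n - 2 * j, ?_⟩⟩,
    ⟨⟨k, ?_⟩, ⟨κd - n, ?_⟩, ⟨κd - n - 2 * k, ?_⟩⟩, ⟨n, ?_⟩⟩ <;>
    simp only [label] <;> push_cast <;> linarith

theorem exists_label_eq {p : (ℚ × ℚ) × (ℚ × ℚ)} (hp : p ∈ PHalfPairs) :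
    ∃ κd κ1 n i : ℤ, 0 ≤ i ∧ i ≤ κd - κ1 ∧ label κd κ1 n i = p := by
  obtain ⟨⟨l₁, l₂⟩, ⟨m₁, m₂⟩⟩ := p
  obtain ⟨⟨⟨j, hj⟩, ⟨a, ha⟩, -⟩, ⟨⟨k, hk⟩, -, -⟩, ⟨n, hn⟩⟩ := hp
  simp only at hj ha hk hn
  refine ⟨a - n, a - n - j - k, n, j, by lia, by lia, ?_⟩
  simp only [label, Prod.mk.injEq]
  push_cast
  refine ⟨⟨?_, ?_⟩, ?_, ?_⟩ <;> linarith

theorem RatIrrep.exists_hasHighestWeight (V : RatIrrep) :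
    ∃ κd κ1 n i : ℤ, HasHighestWeight V.carrier κd κ1 n i :=
  have := V.irreducible
  V.rational.exists_hasHighestWeight

theorem RatIrrep.exists_label (V : RatIrrep) :
    ∃ l, ∀ κd κ1 n i : ℤ, HasHighestWeight V.carrier κd κ1 n i → l = label κd κ1 n i := by
  have := V.irreducible
  obtain ⟨κd, κ1, n, i, h⟩ := V.exists_hasHighestWeight
  refine ⟨label κd κ1 n i, fun κd' κ1' n' i' h' => ?_⟩
  obtain ⟨rfl, rfl, rfl, rfl⟩ := h.unique h'
  rfl

/-- The pair attached to the highest weight of an irreducible rational module. -/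
def RatIrrep.label (V : RatIrrep) : (ℚ × ℚ) × (ℚ × ℚ) := V.exists_label.choose

theorem RatIrrep.label_eq {V : RatIrrep} {κd κ1 n i : ℤ}
    (h : HasHighestWeight V.carrier κd κ1 n i) : V.label = QSP.label κd κ1 n i :=
  V.exists_label.choose_spec _ _ _ _ h

theorem RatIrrep.label_eq_of_equiv {V W : RatIrrep} (e : V.carrier ≃ₗ[U] W.carrier) :
    V.label = W.label := by
  obtain ⟨κd, κ1, n, i, h⟩ := V.exists_hasHighestWeight
  rw [label_eq h, label_eq (h.of_equiv e)]

/-- The map that takes an isomorphism class of irreducible rational modules to the pair attached to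
its highest weight. -/
def RatIrrepClass.label : RatIrrepClass → (ℚ × ℚ) × (ℚ × ℚ) :=
  Quotient.lift RatIrrep.label fun _ _ ⟨e⟩ => RatIrrep.label_eq_of_equiv e

theorem RatIrrepClass.label_mk {V : RatIrrep} {κd κ1 n i : ℤ}
    (h : HasHighestWeight V.carrier κd κ1 n i) : label ⟦V⟧ = QSP.label κd κ1 n i :=
  RatIrrep.label_eq h

theorem RatIrrepClass.label_injective : Function.Injective label := by
  rintro ⟨V⟩ ⟨W⟩ (h : V.label = W.label)
  have := V.irreducible
  have := W.irreducible
  obtain ⟨κd, κ1, n, i, hV⟩ := V.exists_hasHighestWeight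
  obtain ⟨κd', κ1', n', i', hW⟩ := W.exists_hasHighestWeight
  rw [RatIrrep.label_eq hV, RatIrrep.label_eq hW] at h
  obtain ⟨rfl, rfl, rfl, rfl⟩ := QSP.label_injective h
  obtain ⟨e⟩ := hV.nonempty_equiv_L
  obtain ⟨f⟩ := hW.nonempty_equiv_L
  exact Quotient.sound ⟨e.trans f.symm⟩

theorem RatIrrepClass.range_label : Set.range label = PHalfPairs := by
  refine subset_antisymm ?_ fun p hp => ?_
  · rintro _ ⟨⟨V⟩, rfl⟩
    obtain ⟨κd, κ1, n, i, h⟩ := V.exists_hasHighestWeight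
    rw [← Quotient.mk, label_mk h]
    exact label_mem_PHalfPairs h.nonneg h.le_sub
  · obtain ⟨κd, κ1, n, i, h0, hi, rfl⟩ := exists_label_eq hp
    exact ⟨⟦⟨_, isRational_L_domZeta h0 hi, isSimpleModule_L_domZeta h0 hi⟩⟧,
      label_mk (hasHighestWeight_L h0 hi)⟩

end

end QSP

theorem theorem5p5 :
    -- classification, and decomposition into one-dimensional weight spaces
    (∀ (V : Type*) [AddCommGroup V] [Module QSP.Cq V] [Module QSP.U V]
        [IsScalarTower QSP.Cq QSP.U V],
      QSP.IsRational V → IsSimpleModule QSP.U V →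
        (∃ κd κ1 n i : ℤ, 0 ≤ i ∧ i ≤ κd - κ1 ∧
          Nonempty (V ≃ₗ[QSP.U] QSP.L κd κ1 (QSP.qInt n) (QSP.domZeta κd κ1 n i))) ∧
        QSP.IsSumOfWeightLines V) ∧
    -- all the modules in the list occur
    (∀ κd κ1 n i : ℤ, 0 ≤ i → i ≤ κd - κ1 →
      QSP.IsRational (QSP.L κd κ1 (QSP.qInt n) (QSP.domZeta κd κ1 n i)) ∧
      IsSimpleModule QSP.U (QSP.L κd κ1 (QSP.qInt n) (QSP.domZeta κd κ1 n i))) ∧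
    -- taking the highest weight is a bijection from isomorphism classes to pairs
    (∃ hw : QSP.RatIrrepClass → (ℚ × ℚ) × (ℚ × ℚ),
      (∀ (V : QSP.RatIrrep) (κd κ1 n i : ℤ), 0 ≤ i → i ≤ κd - κ1 →
        Nonempty (V.carrier ≃ₗ[QSP.U]
          QSP.L κd κ1 (QSP.qInt n) (QSP.domZeta κd κ1 n i)) →
        hw ⟦V⟧ = QSP.label κd κ1 n i) ∧
      (∀ (V : QSP.RatIrrep) (κd κ1 n i : ℤ) (v : V.carrier), 0 ≤ i → i ≤ κd - κ1 →
        QSP.IsMaximalVector V.carrier κd κ1 (QSP.qInt n) (QSP.domZeta κd κ1 n i) v →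
        hw ⟦V⟧ = QSP.label κd κ1 n i) ∧
      Function.Injective hw ∧ Set.range hw = QSP.PHalfPairs) := by
  refine ⟨fun V _ _ _ _ hV _ => ⟨?_, hV.isSumOfWeightLines⟩,
    fun κd κ1 n i h0 hi => ⟨QSP.isRational_L_domZeta h0 hi, QSP.isSimpleModule_L_domZeta h0 hi⟩,
    QSP.RatIrrepClass.label, fun V κd κ1 n i h0 hi ⟨e⟩ => ?_, fun V κd κ1 n i v h0 hi hv => ?_,
    QSP.RatIrrepClass.label_injective, QSP.RatIrrepClass.range_label⟩
  · obtain ⟨κd, κ1, n, i, h⟩ := hV.exists_hasHighestWeight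
    exact ⟨κd, κ1, n, i, h.nonneg, h.le_sub, h.nonempty_equiv_L⟩
  · exact QSP.RatIrrepClass.label_mk ((QSP.hasHighestWeight_L h0 hi).of_equiv e.symm)
  · exact QSP.RatIrrepClass.label_mk ⟨h0, hi, v, hv⟩
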